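/- For $n\ge 1$ let $A_n$, $C_n$ and $D_n$ denote the reflection groups of these types: $A_n\cong\mathfrak S_{n+1}$ is the symmetry group of the $n$-simplex, $C_n\cong (\mathbb Z/2)^n\rtimes\mathfrak S_n$ is the symmetry group of the $n$-cube (signed permutations of $n$ coordinates), and $D_n\le C_n$ is the subgroup of signed permutations with an even number of coordinate inversions. For a finite group $W$ let $\varphi$ be drawn uniformly at random from the set $\operatorname{End}(W)$ of all homomorphisms $W\to W$, and let $\mathbb E[W]$ and $\sigma[W]$ be the expected value and the standard deviation of the order $|\varphi(W)|$ of its image. Then, as $n\to\infty$, $$\mathbb E[C_{2n}]\sim 2^{2n-1}(2n)!,\qquad \mathbb E[C_{2n+1}]\sim 3\cdot 2^{2n-2}(2n+1)!,\qquad \mathbb E[D_n]\sim 2^{n-2}\,n!,\qquad \mathbb E[A_n]\sim (n+1)!,$$ and $$\sigma[C_{2n}]\sim 2^{2n-1}(2n)!,\qquad \sigma[C_{2n+1}]\sim \sqrt{11}\cdot 2^{2n-2}(2n+1)!,\qquad \sigma[D_n]\sim 2^{n-2}\,n!,\qquad \sigma[A_n]=o\big((n+1)!\big),$$ where $f(n)\sim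 g(n)$ means that $f(n)/g(n)\to 1$. -/

import Mathlib

open Filter Asymptotics
open scoped Nat BigOperators

/-- The reflection group of type `C_n`: the symmetry group of the `n`-cube, that is the group
`(C₂)^n ⋊ S_n` of signed permutations of `n` coordinates. An element is `x σ`, with
`x : Fin n → ℤˣ` the tuple of coordinate inversions and `σ` a permutation of the coordinates;
`σ` acts on the tuples of signs by `x ↦ (i ↦ x (σ⁻¹ i))`. -/
abbrev TypeC (n : ℕ) : Type :=
  (Fin n → ℤˣ) ⋊[(mulAutArrow : Equiv.Perm (Fin n) →* MulAut (Fin n → ℤˣ))] Equiv.Perm (Fin n)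

/-- The subgroup of `C_n` consisting of the signed permutations with an even number of
coordinate inversions (the product of the signs is `1`). -/
def evenInversions (n : ℕ) : Subgroup (TypeC n) where
  carrier := {w | ∏ i, w.left i = 1}
  one_mem' := by simp
  mul_mem' := by
    intro a b ha hb
    have h : ∏ i, b.left (a.right⁻¹ i) = 1 :=
      (Equiv.prod_comp (a.right⁻¹) (fun i => b.left i)).trans hb
    have ha' : ∏ i, a.left i = 1 := ha
    change ∏ i, (a.left i * b.left (a.right⁻¹ i)) = 1
    rw [Finset.prod_mul_distrib, ha', h, one_mul]
  inv_mem' := by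
    intro a ha
    have h : ∏ i, (a.left (a.right⁻¹⁻¹ i))⁻¹ = 1 := by
      rw [Finset.prod_inv_distrib, Equiv.prod_comp (a.right⁻¹⁻¹) (fun i => a.left i),
        show ∏ i, a.left i = 1 from ha, inv_one]
    exact h

/-- The reflection group of type `D_n`: signed permutations of `n` coordinates with an even
number of coordinate inversions. -/
abbrev TypeD (n : ℕ) : Type := evenInversions n

/-- The reflection group of type `A_n`: the symmetry group of the `n`-simplex, that is the
group of all permutations of its `n + 1` vertices. -/
abbrev TypeA (n : ℕ) : Type := Equiv.Perm (Fin (n + 1))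

instance (n : ℕ) : Finite (TypeC n) :=
  Finite.of_equiv _ SemidirectProduct.equivProd.symm

instance finiteEnd (G : Type*) [Group G] [Finite G] : Finite (G →* G) :=
  Finite.of_injective (fun f : G →* G => (f : G → G)) DFunLike.coe_injective

noncomputable section

/-- The mean of a real random variable `X` on a finite sample space `Ω`, all of whose points are
equally likely. -/
def uniformMean {Ω : Type*} [Finite Ω] (X : Ω → ℝ) : ℝ :=
  letI := Fintype.ofFinite Ω
  (∑ ω, X ω) / (Fintype.card Ω : ℝ)

/-- The standard deviation of a real random variable `X` on a finite sample space `Ω`, all of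
whose points are equally likely. -/
def uniformStdDev {Ω : Type*} [Finite Ω] (X : Ω → ℝ) : ℝ :=
  √(uniformMean fun ω => (X ω - uniformMean X) ^ 2)

/-- The order of the image of an endomorphism. -/
def imageOrder {G : Type*} [Group G] (f : G →* G) : ℝ := (Nat.card f.range : ℝ)

/-- The expected order of the image of a uniformly random endomorphism of the finite group `G`. -/
def expectedImageOrder (G : Type*) [Group G] [Finite G] : ℝ :=
  uniformMean fun f : G →* G => imageOrder f

/-- The standard deviation of the order of the image of a uniformly random endomorphism of the
finite group `G`. -/
def stdDevImageOrder (G : Type*) [Group G] [Finite G] : ℝ :=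
  uniformStdDev fun f : G →* G => imageOrder f

end

/-! Divide the order of the image by the order of the group. Up to a negligible set of
endomorphisms, the resulting ratio depends only on a small finite type, and all types are equally
likely. Let `W` contain the copy of the symmetric group `S` on `n` letters.

If an endomorphism is not injective on `S`, it kills the alternating group. It is then determined by
the images of a transposition and, for `C_n`, of one sign change commuting with it, that is, by a
pair of commuting elements of order at most two. There are at most `4 ^ n * numCommutingInvolutions
n` such pairs. Splitting off an orbit gives a recursion showing that this is `o(n!)`
(`tendsto_numCommutingInvolutions`), whereas inner automorphisms alone give `n!` endomorphisms
(`factorial_le_card_end`).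

If it is injective on `S`, it stays injective there after signs are forgotten, so for `n ≥ 7` the
permutation part is conjugation by some `α` (`Equiv.Perm.exists_eq_conj_of_injective`). The abelian
normal subgroup of signs must go to signs, and, once `α` is undone, it does so by an `S`-equivariant
linear map over the field with two elements. On all sign vectors such a map is `a J + b I`, with `J`
the all-ones matrix (`exists_eq_scalarHom`), which gives four types; on even vectors only zero and
the inclusion remain. The type can be chosen independently of the restriction to `S`.

For `C_n` the ratio tends to `0` when `b = 0` and equals `1` for `I`. For `I + J` it is `1` if `n`
is even and `1/2` if `n` is odd, where the all-minus vector is the kernel. Averaging `(0, 0, 1, 1)`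
and `(0, 0, 1, 1/2)` gives means `1/2` and `3/8`, deviations `1/2` and `√11/8`. For `D_n` the
limiting ratios are `0` and `1`; for `A_n` the only one is `1`. `tendsto_imageOrder_of_model` turns
this description into limits. -/

/-! ### Injective endomorphisms of symmetric groups -/

section SymmetricGroup

variable {α : Type*} [Fintype α] [DecidableEq α]

/-- A homomorphism from a large symmetric group that is not injective kills the alternating
group. -/
theorem map_eq_one_of_mem_alternatingGroup {H : Type*} [Group H] (hα : 5 ≤ Fintype.card α)
    (f : Equiv.Perm α →* H) (hf : ¬ Function.Injective f) {σ : Equiv.Perm α}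
    (hσ : σ ∈ alternatingGroup α) : f σ = 1 := by
  have hnt : Nontrivial f.ker := by
    rw [Subgroup.nontrivial_iff_ne_bot]
    exact fun h => hf ((MonoidHom.ker_eq_bot_iff f).1 h)
  exact Equiv.Perm.alternatingGroup_le_of_normal (by simpa using hα) hnt hσ

/-- A nontrivial normal subgroup contains the alternating group, which is not commutative on five or
more letters. -/
theorem Subgroup.eq_bot_of_normal_of_commute (hα : 5 ≤ Fintype.card α)
    (N : Subgroup (Equiv.Perm α)) [N.Normal] (hN : ∀ x ∈ N, ∀ y ∈ N, x * y = y * x) : N = ⊥ := by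
  by_contra h
  have hle := Equiv.Perm.alternatingGroup_le_of_normal (by simpa using hα)
    ((Subgroup.nontrivial_iff_ne_bot N).2 h)
  have hcomm : IsMulCommutative (alternatingGroup α) :=
    ⟨⟨fun x y => Subtype.ext (hN x (hle x.2) y (hle y.2))⟩⟩
  have := alternatingGroup.isMulCommutative_iff_card_le_three.1 hcomm
  rw [Nat.card_eq_fintype_card] at this
  omega

theorem Finset.exists_notMem_of_card_lt (s : Finset α) (h : s.card < Fintype.card α) :
    ∃ z, z ∉ s := by
  by_contra! hs
  rw [Finset.eq_univ_iff_forall.2 hs, Finset.card_univ] at h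
  exact lt_irrefl _ h

theorem Equiv.Perm.exists_cycle_five {α : Type*} [DecidableEq α] {a b c d e : α}
    (h : [a, b, c, d, e].Nodup) :
    ∃ g : Equiv.Perm α, g a = b ∧ g b = c ∧ g c = d ∧ g d = e ∧ g e = a := by
  refine ⟨[a, b, c, d, e].formPerm, ?_⟩
  have := fun i hi => List.formPerm_apply_getElem _ h i hi
  exact ⟨this 0 (by simp), this 1 (by simp), this 2 (by simp), this 3 (by simp),
    by simp⟩

theorem Equiv.Perm.exists_cycle_eight {α : Type*} [DecidableEq α] {a b c d e i j k : α}
    (h : [a, b, c, d, e, i, j, k].Nodup) :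
    ∃ g : Equiv.Perm α, g a = b ∧ g b = c ∧ g c = d ∧ g d = e ∧ g e = i ∧ g i = j ∧ g j = k ∧
      g k = a := by
  refine ⟨[a, b, c, d, e, i, j, k].formPerm, ?_⟩
  have := fun i hi => List.formPerm_apply_getElem _ h i hi
  exact ⟨this 0 (by simp), this 1 (by simp), this 2 (by simp), this 3 (by simp),
    this 4 (by simp), this 5 (by simp), this 6 (by simp), by simp⟩

/-- Among the involutions, transpositions are recognised by the orders of the products of two
conjugates. -/
theorem Equiv.Perm.isSwap_of_forall_mul_conj_pow_six (hα : 7 ≤ Fintype.card α)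
    {x : Equiv.Perm α} (hx : x * x = 1) (hx1 : x ≠ 1)
    (h6 : ∀ g : Equiv.Perm α, (x * (g * x * g⁻¹)) ^ 6 = 1) : x.IsSwap := by
  have hxx : ∀ z, x (x z) = z := fun z => by
    rw [← Equiv.Perm.mul_apply, hx, Equiv.Perm.one_apply]
  have hinj : ∀ {y z}, x y = z → y = x z := fun {y z} h => by rw [← h, hxx]
  have key : ∀ (g : Equiv.Perm α) (z : α), x (g (x (g⁻¹ (x (g (x (g⁻¹ (x (g (x (g⁻¹ (x (g (x (g⁻¹
      (x (g (x (g⁻¹ (x (g (x (g⁻¹ z))))))))))))))))))))))) = z := fun g z => by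
    simpa [pow_succ] using congrArg (fun t : Equiv.Perm α => t z) (h6 g)
  obtain ⟨p, hp⟩ : ∃ p, x p ≠ p := by
    by_contra! h
    exact hx1 (Equiv.ext h)
  by_contra hns
  obtain ⟨r, hr, hrp, hrq⟩ : ∃ r, x r ≠ r ∧ r ≠ p ∧ r ≠ x p := by
    by_contra! h
    refine hns ⟨p, x p, hp.symm, Equiv.ext fun z => ?_⟩
    rw [Equiv.swap_apply_def]
    split_ifs with h1 h2
    · rw [h1]
    · rw [h2, hxx]
    · by_contra h3
      exact h2 (h z h3 h1)
  by_cases hfix : ∃ e, x e = e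
  · obtain ⟨e, he⟩ := hfix
    -- Here `x` acts as `(p, x p)(r, x r)` and its conjugate as `(x p, r)(x r, e)`. These edges
    -- alternate along a path with five vertices, so the product is a 5-cycle on them and its sixth
    -- power moves `p`.
    obtain ⟨g, g1, g2, g3, g4, g5⟩ := Equiv.Perm.exists_cycle_five
      (a := p) (b := x p) (c := r) (d := x r) (e := e) (by
        simp only [List.nodup_cons, List.mem_cons, List.not_mem_nil, or_false, not_or]
        grind)
    have hgi : ∀ z, g⁻¹ (g z) = z := g.symm_apply_apply
    have i1 : g⁻¹ (x p) = p := by rw [← g1, hgi]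
    have i2 : g⁻¹ r = x p := by rw [← g2, hgi]
    have i3 : g⁻¹ (x r) = r := by rw [← g3, hgi]
    have i4 : g⁻¹ e = x r := by rw [← g4, hgi]
    have i5 : g⁻¹ p = e := by rw [← g5, hgi]
    have := key g p
    simp only [i1, i2, i3, i4, i5, g1, g2, g3, g4, g5, hxx, he] at this
    exact hp this
  · push Not at hfix
    -- Without fixed points there are two further 2-cycles. The edges of `x` and of its conjugate
    -- now alternate around an octagon, so the product is a pair of 4-cycles, whose sixth power is
    -- not trivial.
    obtain ⟨t, ht⟩ := Finset.exists_notMem_of_card_lt ({p, x p, r, x r} : Finset α)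
      (lt_of_le_of_lt Finset.card_le_four (by omega))
    obtain ⟨s, hs⟩ := Finset.exists_notMem_of_card_lt ({p, x p, r, x r, t, x t} : Finset α)
      (lt_of_le_of_lt Finset.card_le_six (by omega))
    simp only [Finset.mem_insert, Finset.mem_singleton, not_or] at ht hs
    obtain ⟨g, g1, g2, g3, g4, g5, g6, g7, g8⟩ := Equiv.Perm.exists_cycle_eight
      (a := p) (b := x p) (c := r) (d := x r) (e := t) (i := x t) (j := s) (k := x s) (by
        have := hfix t
        have := hfix s
        simp only [List.nodup_cons, List.mem_cons, List.not_mem_nil, or_false, not_or]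
        grind)
    have hgi : ∀ z, g⁻¹ (g z) = z := g.symm_apply_apply
    have i1 : g⁻¹ (x p) = p := by rw [← g1, hgi]
    have i2 : g⁻¹ r = x p := by rw [← g2, hgi]
    have i3 : g⁻¹ (x r) = r := by rw [← g3, hgi]
    have i4 : g⁻¹ t = x r := by rw [← g4, hgi]
    have i5 : g⁻¹ (x t) = t := by rw [← g5, hgi]
    have i6 : g⁻¹ s = x t := by rw [← g6, hgi]
    have i7 : g⁻¹ (x s) = s := by rw [← g7, hgi]
    have i8 : g⁻¹ p = x s := by rw [← g8, hgi]
    have := key g p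
    simp only [i2, i4, i6, i8, g1, g3, g5, g7, hxx] at this
    grind

/-- Expresses every transposition through those containing a fixed point `z`. -/
theorem Equiv.swap_mul_swap_mul_swap_of_ne {α : Type*} [DecidableEq α] {x y z : α} (hz : y ≠ z)
    (hx : x ≠ y) : Equiv.swap z x * Equiv.swap z y * Equiv.swap z x = Equiv.swap x y := by
  rw [Equiv.mul_swap_eq_swap_mul (Equiv.swap z x) z y, Equiv.swap_apply_left,
    Equiv.swap_apply_of_ne_of_ne hz hx.symm, mul_assoc, Equiv.swap_mul_self, mul_one]

theorem Equiv.swap_commute_of_ne {α : Type*} [DecidableEq α] {a b c d : α} (hac : a ≠ c)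
    (had : a ≠ d) (hbc : b ≠ c) (hbd : b ≠ d) : Commute (Equiv.swap a b) (Equiv.swap c d) := by
  refine Equiv.Perm.Disjoint.commute fun z => ?_
  rcases eq_or_ne z a with rfl | h1
  · exact Or.inr (Equiv.swap_apply_of_ne_of_ne hac had)
  rcases eq_or_ne z b with rfl | h2
  · exact Or.inr (Equiv.swap_apply_of_ne_of_ne hbc hbd)
  · exact Or.inl (Equiv.swap_apply_of_ne_of_ne h1 h2)

/-- The product of two transpositions has order 1, 2 or 3. This makes the exponent six a test that
singles out transpositions among involutions. -/
theorem Equiv.swap_mul_swap_pow_six (a b c d : α) :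
    (Equiv.swap a b * Equiv.swap c d) ^ 6 = 1 := by
  have hs : ∀ x y : α, (Equiv.swap x y) ^ 6 = 1 := fun x y => by
    rw [show 6 = 2 * 3 from rfl, pow_mul, sq, Equiv.swap_mul_self, one_pow]
  have hcomm : Commute (Equiv.swap a b) (Equiv.swap c d) →
      (Equiv.swap a b * Equiv.swap c d) ^ 6 = 1 := fun h => by
    rw [h.mul_pow, hs, hs, one_mul]
  have h3 : ∀ x y z : α, x ≠ y → x ≠ z → y ≠ z →
      (Equiv.swap x y * Equiv.swap x z) ^ 6 = 1 := fun x y z h1 h2 h3 => by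
    have h := (Equiv.Perm.isThreeCycle_swap_mul_swap_same h1 h2 h3).orderOf
    rw [show 6 = 3 * 2 from rfl, pow_mul, ← h, pow_orderOf_eq_one, one_pow]
  rcases eq_or_ne a b with rfl | hab
  · exact hcomm (by rw [Equiv.swap_self]; exact Commute.one_left _)
  rcases eq_or_ne c d with rfl | hcd
  · exact hcomm (by rw [Equiv.swap_self]; exact Commute.one_right _)
  rcases eq_or_ne a c with rfl | hac
  · rcases eq_or_ne b d with rfl | hbd
    · exact hcomm (Commute.refl _)
    · exact h3 _ _ _ hab hcd hbd
  rcases eq_or_ne a d with rfl | had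
  · rcases eq_or_ne b c with rfl | hbd
    · exact hcomm (by rw [Equiv.swap_comm])
    · rw [Equiv.swap_comm c a]
      exact h3 _ _ _ hab hac hbd
  rcases eq_or_ne b c with rfl | hbc
  · rw [Equiv.swap_comm a b]
    exact h3 _ _ _ hab.symm hcd had
  rcases eq_or_ne b d with rfl | hbd
  · rw [Equiv.swap_comm a b, Equiv.swap_comm c b]
    exact h3 _ _ _ hab.symm hbc hac
  · exact hcomm (Equiv.swap_commute_of_ne hac had hbc hbd)

theorem Equiv.not_commute_swap_swap {α : Type*} [DecidableEq α] {o a b : α} (ha : a ≠ o) (hb : b ≠ o)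
    (hab : a ≠ b) : ¬ Commute (Equiv.swap o a) (Equiv.swap o b) := fun h => by
  have := congrArg (fun t : Equiv.Perm α => t o) h.eq
  simp only [Equiv.Perm.mul_apply, Equiv.swap_apply_left,
    Equiv.swap_apply_of_ne_of_ne hb hab.symm, Equiv.swap_apply_of_ne_of_ne ha hab] at this
  exact hab this.symm

/-- Two transpositions that do not commute share exactly one point. -/
theorem Equiv.Perm.IsSwap.exists_of_not_commute {α : Type*} [DecidableEq α]
    {s t : Equiv.Perm α} (hs : s.IsSwap) (ht : t.IsSwap) (h : ¬ Commute s t) :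
    ∃ p q r, p ≠ q ∧ p ≠ r ∧ q ≠ r ∧ s = Equiv.swap p q ∧ t = Equiv.swap p r := by
  obtain ⟨a, b, hab, rfl⟩ := hs
  obtain ⟨c, d, hcd, rfl⟩ := ht
  rcases eq_or_ne a c with rfl | hac
  · refine ⟨a, b, d, hab, hcd, ?_, rfl, rfl⟩
    rintro rfl
    exact h (Commute.refl _)
  rcases eq_or_ne a d with rfl | had
  · refine ⟨a, b, c, hab, hac, ?_, rfl, Equiv.swap_comm _ _⟩
    rintro rfl
    exact h (by rw [Equiv.swap_comm])
  rcases eq_or_ne b c with rfl | hbc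
  · exact ⟨b, a, d, hab.symm, hcd, had, Equiv.swap_comm _ _, rfl⟩
  rcases eq_or_ne b d with rfl | hbd
  · exact ⟨b, a, c, hab.symm, hbc, hac, Equiv.swap_comm _ _, Equiv.swap_comm _ _⟩
  · exact absurd (Equiv.swap_commute_of_ne hac had hbc hbd) h

/-- An endomorphism of the symmetric group that maps transpositions to transpositions injectively
is inner. -/
theorem Equiv.Perm.exists_eq_conj_of_isSwap (hα : 3 ≤ Fintype.card α)
    (f : Equiv.Perm α →* Equiv.Perm α) (hf : Function.Injective f)
    (hsw : ∀ a b, a ≠ b → (f (Equiv.swap a b)).IsSwap) :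
    ∃ g : Equiv.Perm α, ∀ σ, f σ = g * σ * g⁻¹ := by
  obtain ⟨o, -⟩ := Finset.exists_notMem_of_card_lt (∅ : Finset α) (by simp; omega)
  obtain ⟨a, ha⟩ := Finset.exists_notMem_of_card_lt ({o} : Finset α) (by simp; omega)
  obtain ⟨b, hb⟩ := Finset.exists_notMem_of_card_lt ({o, a} : Finset α)
    (lt_of_le_of_lt Finset.card_le_two (by omega))
  simp only [Finset.mem_singleton, Finset.mem_insert, not_or] at ha hb
  have hnc : ∀ {x y : α}, x ≠ o → y ≠ o → x ≠ y →
      ¬ Commute (f (Equiv.swap o x)) (f (Equiv.swap o y)) := fun {x y} hx hy hxy h =>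
    Equiv.not_commute_swap_swap hx hy hxy (hf (by rw [map_mul, map_mul]; exact h.eq))
  obtain ⟨p, q, r, hpq, hpr, hqr, hsa, hsb⟩ := (hsw o a (Ne.symm ha)).exists_of_not_commute
    (hsw o b (Ne.symm hb.1)) (hnc ha hb.1 (Ne.symm hb.2))
  -- The images of the transpositions at `o` pairwise fail to commute, so any two meet in a point.
  -- One that misses `p` meets both `(p q)` and `(p r)`, hence is `(q r) = f (a b)`, contradicting
  -- injectivity. All images thus share `p`, and the other point defines the conjugator.
  have hmem : ∀ i, i ≠ o → f (Equiv.swap o i) p ≠ p := by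
    intro i hi
    rcases eq_or_ne i a with rfl | hia
    · rw [hsa, Equiv.swap_apply_left]; exact hpq.symm
    rcases eq_or_ne i b with rfl | hib
    · rw [hsb, Equiv.swap_apply_left]; exact hpr.symm
    intro hp
    have h1 := hnc hi ha hia
    have h2 := hnc hi hb.1 hib
    obtain ⟨c, d, hcd, hc⟩ := hsw o i (Ne.symm hi)
    rw [hc] at hp h1 h2
    rw [hsa] at h1
    rw [hsb] at h2
    have hcp : c ≠ p := by
      rintro rfl
      rw [Equiv.swap_apply_left] at hp
      exact hcd hp.symm
    have hdp : d ≠ p := by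
      rintro rfl
      rw [Equiv.swap_apply_right] at hp
      exact hcd hp
    have hq : q = c ∨ q = d := by
      by_contra! h
      exact h1 (Equiv.swap_commute_of_ne hcp h.1.symm hdp h.2.symm)
    have hr : r = c ∨ r = d := by
      by_contra! h
      exact h2 (Equiv.swap_commute_of_ne hcp h.1.symm hdp h.2.symm)
    have heq : f (Equiv.swap o i) = f (Equiv.swap a b) := by
      have h3 : Equiv.swap a b = Equiv.swap o a * Equiv.swap o b * Equiv.swap o a := by
        rw [Equiv.swap_mul_swap_mul_swap_of_ne hb.1 (Ne.symm hb.2)]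
      rw [h3, map_mul, map_mul, hsa, hsb,
        Equiv.swap_mul_swap_mul_swap_of_ne hpr.symm hqr, hc]
      rcases hq with rfl | rfl <;> rcases hr with rfl | rfl
      · exact absurd rfl hqr
      · rfl
      · rw [Equiv.swap_comm]
      · exact absurd rfl hqr
    have := congrArg (fun t : Equiv.Perm α => t o) (hf heq)
    simp only [Equiv.swap_apply_left] at this
    rw [Equiv.swap_apply_of_ne_of_ne (Ne.symm ha) (Ne.symm hb.1)] at this
    exact hi this
  have hstar : ∀ i, f (Equiv.swap o i) = Equiv.swap p (f (Equiv.swap o i) p) := by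
    intro i
    rcases eq_or_ne i o with rfl | hi
    · have h1 : f (Equiv.swap i i) = 1 := by
        rw [Equiv.swap_self]; exact map_one f
      rw [h1, Equiv.Perm.one_apply, Equiv.swap_self]; rfl
    have hp := hmem i hi
    obtain ⟨c, d, hcd, hc⟩ := hsw o i (Ne.symm hi)
    rw [hc] at hp ⊢
    rcases eq_or_ne p c with rfl | hpc
    · rw [Equiv.swap_apply_left]
    rcases eq_or_ne p d with rfl | hpd
    · rw [Equiv.swap_apply_right, Equiv.swap_comm]
    · exact absurd (Equiv.swap_apply_of_ne_of_ne hpc hpd) hp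
  have hginj : Function.Injective fun i => f (Equiv.swap o i) p := by
    intro i j hij
    have h1 : f (Equiv.swap o i) = f (Equiv.swap o j) := by
      rw [hstar i, hstar j]
      exact congrArg _ hij
    have := congrArg (fun t : Equiv.Perm α => t o) (hf h1)
    simpa only [Equiv.swap_apply_left] using this
  let g : Equiv.Perm α := Equiv.ofBijective _ (Finite.injective_iff_bijective.1 hginj)
  have hg : ∀ i, g i = f (Equiv.swap o i) p := fun i => rfl
  have hgo : g o = p := by
    rw [hg, Equiv.swap_self]
    change f 1 p = p
    rw [map_one, Equiv.Perm.one_apply]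
  have hgs : ∀ i, f (Equiv.swap o i) = Equiv.swap (g o) (g i) := fun i => by
    rw [hstar i, hgo, ← hg]
  refine ⟨g, fun σ => ?_⟩
  have hext : f = (MulAut.conj g).toMonoidHom := by
    refine MonoidHom.eq_of_eqOn_dense Equiv.Perm.closure_isSwap ?_
    rintro _ ⟨i, j, hij, rfl⟩
    change f (Equiv.swap i j) = g * Equiv.swap i j * g⁻¹
    rw [Equiv.mul_swap_eq_swap_mul, mul_inv_cancel_right]
    rcases eq_or_ne i o with rfl | hi
    · exact hgs j
    rcases eq_or_ne j o with rfl | hj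
    · rw [Equiv.swap_comm, hgs, Equiv.swap_comm]
    · rw [← Equiv.swap_mul_swap_mul_swap_of_ne hj hij, map_mul, map_mul, hgs, hgs,
        Equiv.swap_mul_swap_mul_swap_of_ne (g.injective.ne hj) (g.injective.ne hij)]
  rw [hext]
  rfl

/-- Injective endomorphisms of the symmetric group on at least `7` letters are inner. -/
theorem Equiv.Perm.exists_eq_conj_of_injective (hα : 7 ≤ Fintype.card α)
    (f : Equiv.Perm α →* Equiv.Perm α) (hf : Function.Injective f) :
    ∃ g : Equiv.Perm α, ∀ σ, f σ = g * σ * g⁻¹ := by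
  refine Equiv.Perm.exists_eq_conj_of_isSwap (by omega) f hf fun a b hab => ?_
  have hsurj : Function.Surjective f := Finite.surjective_of_injective hf
  refine Equiv.Perm.isSwap_of_forall_mul_conj_pow_six hα ?_ ?_ ?_
  · rw [← map_mul, Equiv.swap_mul_self, map_one]
  · intro h
    rw [← map_one f] at h
    have := congrArg (fun t : Equiv.Perm α => t a) (hf h)
    simp only [Equiv.swap_apply_left, Equiv.Perm.one_apply] at this
    exact hab this.symm
  · intro g
    obtain ⟨g, rfl⟩ := hsurj g
    rw [← map_inv, ← map_mul, ← map_mul, ← map_mul, ← map_pow, Equiv.mul_swap_eq_swap_mul,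
      mul_inv_cancel_right, Equiv.swap_mul_swap_pow_six, map_one]

end SymmetricGroup

/-! ### Counting commuting pairs of involutions -/

section CommutingInvolutions

/-- The pairs of commuting elements of order at most two of a group. -/
abbrev CommutingInvolutions (G : Type*) [Group G] : Type _ :=
  {p : G × G // p.1 * p.1 = 1 ∧ p.2 * p.2 = 1 ∧ p.1 * p.2 = p.2 * p.1}

/-- The number of pairs of commuting permutations of order at most two on `n` letters. -/
noncomputable def numCommutingInvolutions (n : ℕ) : ℕ :=
  Nat.card (CommutingInvolutions (Equiv.Perm (Fin n)))

theorem card_commutingInvolutions_perm (α : Type*) [Finite α] :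
    Nat.card (CommutingInvolutions (Equiv.Perm α)) = numCommutingInvolutions (Nat.card α) := by
  let e : Equiv.Perm α ≃* Equiv.Perm (Fin (Nat.card α)) := (Finite.equivFin α).permCongrHom
  refine Nat.card_congr ((Equiv.prodCongr e.toEquiv e.toEquiv).subtypeEquiv fun p => ?_)
  simp only [Equiv.prodCongr_apply, MulEquiv.toEquiv_eq_coe, Prod.map_fst, Prod.map_snd,
    EquivLike.coe_coe, ← map_mul, EmbeddingLike.map_eq_one_iff, EmbeddingLike.apply_eq_iff_eq]

variable {α : Type*} [DecidableEq α]

/-- The data recording the orbit of `o` under a pair of commuting involutions. -/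
def orbitTriple (o : α) (p : CommutingInvolutions (Equiv.Perm α)) : α × α × α :=
  (p.1.1 o, p.1.2 o, p.1.1 (p.1.2 o))

/-- The point `o` together with the entries of `t`. -/
def orbitFinset (o : α) (t : α × α × α) : Finset α := {o, t.1, t.2.1, t.2.2}

theorem CommutingInvolutions.apply_apply {α : Type*} (p : CommutingInvolutions (Equiv.Perm α)) (z : α) :
    p.1.1 (p.1.1 z) = z ∧ p.1.2 (p.1.2 z) = z ∧ p.1.1 (p.1.2 z) = p.1.2 (p.1.1 z) :=
  ⟨Equiv.congr_fun p.2.1 z, Equiv.congr_fun p.2.2.1 z, Equiv.congr_fun p.2.2.2 z⟩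

/-- `orbitFinset` is the orbit of `o` under the group generated by the pair, so its complement is
invariant. -/
theorem notMem_orbitFinset_iff (o : α)
    (p : CommutingInvolutions (Equiv.Perm α)) (z : α) :
    (p.1.1 z ∉ orbitFinset o (orbitTriple o p) ↔ z ∉ orbitFinset o (orbitTriple o p)) ∧
      (p.1.2 z ∉ orbitFinset o (orbitTriple o p) ↔ z ∉ orbitFinset o (orbitTriple o p)) := by
  have h := p.apply_apply
  have h1 : ∀ a b, p.1.1 a = b ↔ a = p.1.1 b := fun a b =>
    ⟨fun hab => by rw [← hab, (h a).1], fun hab => by rw [hab, (h b).1]⟩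
  have h2 : ∀ a b, p.1.2 a = b ↔ a = p.1.2 b := fun a b =>
    ⟨fun hab => by rw [← hab, (h a).2.1], fun hab => by rw [hab, (h b).2.1]⟩
  simp only [orbitFinset, orbitTriple, Finset.mem_insert, Finset.mem_singleton, not_or, h1, h2,
    (h _).1, (h _).2.1]
  rw [← (h (p.1.2 o)).2.2, (h o).2.1, ← (h o).2.2]
  tauto

/-- The restriction of a pair of commuting involutions to the complement of the orbit of `o`. -/
def CommutingInvolutions.restrict (o : α) (p : CommutingInvolutions (Equiv.Perm α)) :
    Σ t : α × α × α, CommutingInvolutions (Equiv.Perm {z // z ∉ orbitFinset o t}) :=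
  ⟨orbitTriple o p,
    ⟨(p.1.1.subtypePerm fun z => (notMem_orbitFinset_iff o p z).1,
      p.1.2.subtypePerm fun z => (notMem_orbitFinset_iff o p z).2),
      Equiv.ext fun z => Subtype.ext (p.apply_apply z).1,
      Equiv.ext fun z => Subtype.ext (p.apply_apply z).2.1,
      Equiv.ext fun z => Subtype.ext (p.apply_apply z).2.2⟩⟩

/-- On the orbit of `o` both involutions can be read off from the triple; off the orbit they are the
recorded restrictions. -/
theorem CommutingInvolutions.restrict_injective (o : α) :
    Function.Injective (CommutingInvolutions.restrict o) := by
  intro p q h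
  have ht : orbitTriple o p = orbitTriple o q := congrArg Sigma.fst h
  have hout : ∀ z, z ∉ orbitFinset o (orbitTriple o p) → p.1.1 z = q.1.1 z ∧ p.1.2 z = q.1.2 z := by
    intro z hz
    -- The restrictions live on a subtype depending on the triple, so values are compared in `α`
    -- after generalizing the dependent pair.
    have key : ∀ (s t : Σ t : α × α × α, CommutingInvolutions (Equiv.Perm {z // z ∉ orbitFinset o t})),
        s = t → ∀ (h1 : z ∉ orbitFinset o s.1) (h2 : z ∉ orbitFinset o t.1),
        ((s.2.1.1 ⟨z, h1⟩ : {z // z ∉ orbitFinset o s.1}) : α) = (t.2.1.1 ⟨z, h2⟩).1 ∧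
        ((s.2.1.2 ⟨z, h1⟩ : {z // z ∉ orbitFinset o s.1}) : α) = (t.2.1.2 ⟨z, h2⟩).1 := by
      rintro s _ rfl h1 h2
      exact ⟨rfl, rfl⟩
    exact key _ _ h hz (by rw [ht] at hz; exact hz)
  have hp := p.apply_apply
  have hq := q.apply_apply
  have e1 : p.1.1 o = q.1.1 o := congrArg (fun t => t.1) ht
  have e2 : p.1.2 o = q.1.2 o := congrArg (fun t => t.2.1) ht
  have e3 : p.1.1 (p.1.2 o) = q.1.1 (q.1.2 o) := congrArg (fun t => t.2.2) ht
  have hin : ∀ z, z ∈ orbitFinset o (orbitTriple o p) → p.1.1 z = q.1.1 z ∧ p.1.2 z = q.1.2 z := by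
    intro z hz
    simp only [orbitFinset, orbitTriple, Finset.mem_insert, Finset.mem_singleton] at hz
    rcases hz with rfl | rfl | rfl | rfl
    · exact ⟨e1, e2⟩
    · rw [(hp _).1, ← (hp _).2.2, e3, e1, (hq _).1, (hq _).2.2]
      exact ⟨rfl, rfl⟩
    · rw [(hp _).2.1, e3, e2, (hq _).2.1]
      exact ⟨rfl, rfl⟩
    · rw [(hp _).1, ← (hp (p.1.2 o)).2.2, (hp _).2.1, e3, (hq _).1, ← (hq (q.1.2 o)).2.2,
        (hq _).2.1]
      exact ⟨e2, e1⟩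
  have hall : ∀ z, p.1.1 z = q.1.1 z ∧ p.1.2 z = q.1.2 z := fun z => by
    by_cases hz : z ∈ orbitFinset o (orbitTriple o p)
    exacts [hin z hz, hout z hz]
  exact Subtype.ext (Prod.ext (Equiv.ext fun z => (hall z).1) (Equiv.ext fun z => (hall z).2))

/-- The acting group is a quotient of the Klein four-group, so the orbit has 1, 2 or 4 points. When
it has two, exactly one of the two involutions and their product fixes `o`, which gives three
subcases. -/
theorem orbitTriple_cases (o : α)
    (p : CommutingInvolutions (Equiv.Perm α)) :
    orbitTriple o p = (o, o, o) ∨ (∃ j, j ≠ o ∧ orbitTriple o p = (o, j, j)) ∨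
      (∃ j, j ≠ o ∧ orbitTriple o p = (j, o, j)) ∨ (∃ j, j ≠ o ∧ orbitTriple o p = (j, j, o)) ∨
      (orbitFinset o (orbitTriple o p)).card = 4 := by
  have h := p.apply_apply
  by_cases h1 : p.1.1 o = o
  · have h3 : p.1.1 (p.1.2 o) = p.1.2 o := by rw [(h o).2.2, h1]
    by_cases h2 : p.1.2 o = o
    · left
      simp only [orbitTriple, h1, h2]
    · right; left
      exact ⟨_, h2, by simp only [orbitTriple, h1, h3]⟩
  by_cases h2 : p.1.2 o = o
  · right; right; left
    exact ⟨_, h1, by simp only [orbitTriple, h2]⟩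
  by_cases h3 : p.1.1 (p.1.2 o) = o
  · right; right; right; left
    refine ⟨_, h1, ?_⟩
    have : p.1.2 o = p.1.1 o := by rw [← (h (p.1.2 o)).1, h3]
    simp only [orbitTriple, this, (h o).1]
  · right; right; right; right
    have h4 : p.1.1 o ≠ p.1.2 o := fun h4 => h3 (by rw [← h4, (h o).1])
    have h5 : p.1.1 o ≠ p.1.1 (p.1.2 o) := fun h5 => h2 (p.1.1.injective h5).symm
    have h6 : p.1.2 o ≠ p.1.1 (p.1.2 o) := fun h6 => by
      rw [(h o).2.2] at h6
      exact h1 (p.1.2.injective h6).symm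
    simp only [orbitFinset, orbitTriple]
    rw [Finset.card_insert_of_notMem, Finset.card_insert_of_notMem, Finset.card_pair h6]
    · simp [h4, h5]
    · simp [Ne.symm h1, Ne.symm h2, Ne.symm h3]

theorem card_commutingInvolutions_restrict [Fintype α] (o : α) (t : α × α × α) :
    Nat.card (CommutingInvolutions (Equiv.Perm {z // z ∉ orbitFinset o t})) =
      numCommutingInvolutions (Fintype.card α - (orbitFinset o t).card) := by
  rw [card_commutingInvolutions_perm, Nat.card_eq_fintype_card, Fintype.card_subtype_compl,
    Fintype.card_coe]

/-- Remove the orbit of one point. There is one triple with an orbit of size 1, at most `3 n` with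
size 2, and at most `n ^ 3` with size 4. -/
theorem numCommutingInvolutions_card_le [Fintype α] [Nonempty α] :
    numCommutingInvolutions (Fintype.card α) ≤
      numCommutingInvolutions (Fintype.card α - 1) +
        3 * Fintype.card α * numCommutingInvolutions (Fintype.card α - 2) +
        Fintype.card α ^ 3 * numCommutingInvolutions (Fintype.card α - 4) := by
  classical
  obtain ⟨o⟩ := ‹Nonempty α›
  set n := Fintype.card α with hn
  set A := numCommutingInvolutions with hA
  -- Only triples that occur are summed over; an arbitrary triple could span three points, a size
  -- for which the bound has no term.
  let V : Finset (α × α × α) := Finset.univ.filter fun t =>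
    ∃ p : CommutingInvolutions (Equiv.Perm α), orbitTriple o p = t
  have h1 : A n ≤ ∑ t ∈ V, A (n - (orbitFinset o t).card) := by
    let F : CommutingInvolutions (Equiv.Perm α) →
        Σ t : V, CommutingInvolutions (Equiv.Perm {z // z ∉ orbitFinset o t.1}) := fun p =>
      ⟨⟨(p.restrict o).1, by simp only [V, Finset.mem_filter, Finset.mem_univ, true_and];
                             exact ⟨p, rfl⟩⟩, (p.restrict o).2⟩
    have hF : Function.Injective F := fun p q h =>
      CommutingInvolutions.restrict_injective o
        (congrArg (fun s : Σ t : V, CommutingInvolutions (Equiv.Perm {z // z ∉ orbitFinset o t.1}) =>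
          (⟨s.1.1, s.2⟩ : Σ t : α × α × α,
            CommutingInvolutions (Equiv.Perm {z // z ∉ orbitFinset o t}))) h)
    have := Nat.card_le_card_of_injective F hF
    rw [card_commutingInvolutions_perm, Nat.card_eq_fintype_card, Nat.card_sigma] at this
    simp only [card_commutingInvolutions_restrict] at this
    exact this.trans (le_of_eq (Finset.sum_coe_sort V fun t => A (n - (orbitFinset o t).card)))
  have h2 : ∀ t ∈ V, A (n - (orbitFinset o t).card) ≤
      (if t = (o, o, o) then A (n - 1) else 0) +
      (if o = t.1 ∧ t.2.1 = t.2.2 then A (n - 2) else 0) +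
      (if o = t.2.1 ∧ t.1 = t.2.2 then A (n - 2) else 0) +
      (if o = t.2.2 ∧ t.1 = t.2.1 then A (n - 2) else 0) + A (n - 4) := by
    intro t ht
    simp only [V, Finset.mem_filter, Finset.mem_univ, true_and] at ht
    obtain ⟨p, rfl⟩ := ht
    rcases orbitTriple_cases o p with h | ⟨j, hj, h⟩ | ⟨j, hj, h⟩ | ⟨j, hj, h⟩ | h
    · rw [h, if_pos rfl]
      have : (orbitFinset o (o, o, o)).card = 1 := by simp [orbitFinset]
      rw [this]; omega
    · rw [h]
      have : (orbitFinset o (o, j, j)).card = 2 := by simp [orbitFinset, Finset.card_pair hj.symm]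
      rw [this]; simp; omega
    · rw [h]
      have : (orbitFinset o (j, o, j)).card = 2 := by
        simp [orbitFinset, Finset.card_pair hj.symm]
      rw [this]; simp; omega
    · rw [h]
      have : (orbitFinset o (j, j, o)).card = 2 := by
        simp [orbitFinset, Finset.card_pair hj]
      rw [this]; simp; omega
    · rw [h]; omega
  calc A n ≤ ∑ t ∈ V, A (n - (orbitFinset o t).card) := h1
    _ ≤ _ := Finset.sum_le_sum h2
    _ ≤ _ := Finset.sum_le_sum_of_subset (Finset.subset_univ V)
    _ = _ := by
      simp only [Finset.sum_add_distrib, Finset.sum_ite_eq', Finset.mem_univ, if_true,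
        Finset.sum_const, Finset.card_univ, Fintype.card_prod, Fintype.sum_prod_type, ite_and,
        Finset.sum_ite_eq, smul_eq_mul, ← hn, Finset.sum_ite_irrel]
      simp only [mul_zero, Finset.sum_ite_eq, Finset.mem_univ, if_true]
      ring

theorem numCommutingInvolutions_le (m : ℕ) :
    numCommutingInvolutions (m + 4) ≤ numCommutingInvolutions (m + 3) +
      3 * (m + 4) * numCommutingInvolutions (m + 2) +
      (m + 4) ^ 3 * numCommutingInvolutions m := by
  simpa using numCommutingInvolutions_card_le (α := Fin (m + 4))

/-- Once `m + 4 ≥ 3 K` the recursion cannot exceed the maximum of the earlier terms, so `u` is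
bounded. Feeding the bound back in gives decay like `1 / m`. -/
theorem tendsto_zero_of_le_div {u : ℕ → ℝ} (h0 : ∀ n, 0 ≤ u n) {K : ℝ} (hK : 0 ≤ K)
    (h : ∀ m, u (m + 4) ≤ K / ((m : ℝ) + 4) * (u (m + 3) + u (m + 2) + u m)) :
    Tendsto u atTop (nhds 0) := by
  obtain ⟨N, hN⟩ := exists_nat_ge (3 * K)
  set M := ∑ k ∈ Finset.range (N + 4), u k with hM
  have hM0 : 0 ≤ M := Finset.sum_nonneg fun k _ => h0 k
  have hb : ∀ n, u n ≤ M := by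
    intro n
    induction n using Nat.strong_induction_on with
    | _ n ih =>
      rcases lt_or_ge n (N + 4) with hn | hn
      · exact Finset.single_le_sum (f := u) (fun k _ => h0 k) (Finset.mem_range.2 hn)
      · obtain ⟨m, rfl⟩ : ∃ m, n = m + 4 := ⟨n - 4, by omega⟩
        have hmN : (N : ℝ) ≤ m := by exact_mod_cast (by omega : N ≤ m)
        have hpos : (0 : ℝ) < (m : ℝ) + 4 := by positivity
        refine (h m).trans ?_
        have h3 : u (m + 3) + u (m + 2) + u m ≤ 3 * M := by
          linarith [ih (m + 3) (by omega), ih (m + 2) (by omega), ih m (by omega)]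
        calc K / ((m : ℝ) + 4) * (u (m + 3) + u (m + 2) + u m)
            ≤ K / ((m : ℝ) + 4) * (3 * M) := by gcongr
          _ = (3 * K / ((m : ℝ) + 4)) * M := by ring
          _ ≤ 1 * M := by
            gcongr
            rw [div_le_one hpos]
            linarith
          _ = M := one_mul M
  rw [← tendsto_add_atTop_iff_nat 4]
  have hlim : Tendsto (fun m : ℕ => K * (3 * M) / ((m + 4 : ℕ) : ℝ)) atTop (nhds 0) :=
    (tendsto_add_atTop_iff_nat 4).2 (tendsto_const_div_atTop_nhds_zero_nat _)
  refine squeeze_zero (fun m => h0 _) (fun m => (h m).trans ?_) hlim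
  have h3 : u (m + 3) + u (m + 2) + u m ≤ 3 * M := by
    linarith [hb (m + 3), hb (m + 2), hb m]
  push_cast
  calc K / ((m : ℝ) + 4) * (u (m + 3) + u (m + 2) + u m)
      ≤ K / ((m : ℝ) + 4) * (3 * M) := by gcongr
    _ = K * (3 * M) / ((m : ℝ) + 4) := by ring

theorem tendsto_numCommutingInvolutions :
    Tendsto (fun n : ℕ => (4 : ℝ) ^ n * numCommutingInvolutions n / (n ! : ℝ)) atTop (nhds 0) := by
  -- Normalizing turns the three coefficients into `4`, `3 * 4 ^ 2` and `4 ^ 4` times quotients of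
  -- the form `(m + 4) / (m + j)`. With these bounded by 2, 2 and 4, the largest is `256 * 16 =
  -- 4096`.
  refine tendsto_zero_of_le_div (fun n => by positivity) (K := 4096) (by norm_num) fun m => ?_
  have h : (numCommutingInvolutions (m + 4) : ℝ) ≤ numCommutingInvolutions (m + 3) +
      3 * (m + 4) * numCommutingInvolutions (m + 2) +
      (m + 4) ^ 3 * numCommutingInvolutions m := by
    exact_mod_cast numCommutingInvolutions_le m
  set a := (numCommutingInvolutions m : ℝ)
  set b := (numCommutingInvolutions (m + 2) : ℝ)
  set c := (numCommutingInvolutions (m + 3) : ℝ)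
  have ha : 0 ≤ a := Nat.cast_nonneg _
  have hb : 0 ≤ b := Nat.cast_nonneg _
  have hc : 0 ≤ c := Nat.cast_nonneg _
  have hf : (0 : ℝ) < (m ! : ℝ) := by exact_mod_cast Nat.factorial_pos m
  have hm : (0 : ℝ) ≤ m := Nat.cast_nonneg m
  simp only [Nat.factorial_succ, Nat.cast_mul, Nat.cast_add, Nat.cast_one, Nat.cast_ofNat]
  calc (4 : ℝ) ^ (m + 4) * (numCommutingInvolutions (m + 4) : ℝ) /
        ((m + 3 + 1) * ((m + 2 + 1) * ((m + 1 + 1) * ((m + 1) * (m ! : ℝ)))))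
      ≤ (4 : ℝ) ^ (m + 4) * (c + 3 * (m + 4) * b + (m + 4) ^ 3 * a) /
        ((m + 3 + 1) * ((m + 2 + 1) * ((m + 1 + 1) * ((m + 1) * (m ! : ℝ))))) := by gcongr
    _ = 1 / (m + 4 : ℝ) * (4 * (4 ^ (m + 3) * c / ((m + 2 + 1) * ((m + 1 + 1) * ((m + 1) * (m ! : ℝ)))))
        + 48 * ((m + 4) / (m + 3)) * (4 ^ (m + 2) * b / ((m + 1 + 1) * ((m + 1) * (m ! : ℝ)))) +
        256 * ((m + 4) / (m + 3) * ((m + 4) / (m + 2)) * ((m + 4) / (m + 1))) *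
          (4 ^ m * a / (m ! : ℝ))) := by
      field_simp
      ring
    _ ≤ 1 / (m + 4 : ℝ) * (4096 * (4 ^ (m + 3) * c / ((m + 2 + 1) * ((m + 1 + 1) * ((m + 1) * (m ! : ℝ)))))
        + 48 * 2 * (4 ^ (m + 2) * b / ((m + 1 + 1) * ((m + 1) * (m ! : ℝ)))) +
        256 * (2 * 2 * 4) * (4 ^ m * a / (m ! : ℝ))) := by
      have e1 : (m + 4 : ℝ) / (m + 3) ≤ 2 := by rw [div_le_iff₀ (by positivity)]; linarith
      have e2 : (m + 4 : ℝ) / (m + 2) ≤ 2 := by rw [div_le_iff₀ (by positivity)]; linarith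
      have e3 : (m + 4 : ℝ) / (m + 1) ≤ 4 := by rw [div_le_iff₀ (by positivity)]; linarith
      gcongr
      norm_num
    _ ≤ 1 / (m + 4 : ℝ) * (4096 * (4 ^ (m + 3) * c / ((m + 2 + 1) * ((m + 1 + 1) * ((m + 1) * (m ! : ℝ)))))
        + 4096 * (4 ^ (m + 2) * b / ((m + 1 + 1) * ((m + 1) * (m ! : ℝ)))) +
        4096 * (4 ^ m * a / (m ! : ℝ))) := by
      gcongr <;> norm_num
    _ = _ := by ring

/-- Forgetting signs sends a pair to a commuting pair of permutations; the two sign vectors account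
for `4 ^ n`. -/
theorem card_commutingInvolutions_typeC_le (n : ℕ) :
    Nat.card (CommutingInvolutions (TypeC n)) ≤ 4 ^ n * numCommutingInvolutions n := by
  let F : CommutingInvolutions (TypeC n) →
      ((Fin n → ℤˣ) × (Fin n → ℤˣ)) × CommutingInvolutions (Equiv.Perm (Fin n)) := fun p =>
    ((p.1.1.left, p.1.2.left), ⟨(p.1.1.right, p.1.2.right),
      congrArg SemidirectProduct.right p.2.1, congrArg SemidirectProduct.right p.2.2.1,
      congrArg SemidirectProduct.right p.2.2.2⟩)
  have hF : Function.Injective F := by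
    intro p q h
    simp only [F, Prod.mk.injEq, Subtype.mk.injEq] at h
    exact Subtype.ext (Prod.ext (SemidirectProduct.ext h.1.1 h.2.1)
      (SemidirectProduct.ext h.1.2 h.2.2))
  refine (Nat.card_le_card_of_injective F hF).trans (le_of_eq ?_)
  rw [Nat.card_prod, Nat.card_prod, numCommutingInvolutions]
  congr 1
  simp only [Nat.card_eq_fintype_card, Fintype.card_pi, Finset.prod_const, Finset.card_univ,
    Fintype.card_fin, Fintype.card_units_int, ← mul_pow]
  norm_num

theorem card_involutions_le (G : Type*) [Group G] [Finite G] :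
    Nat.card {x : G // x * x = 1} ≤ Nat.card (CommutingInvolutions G) :=
  Nat.card_le_card_of_injective
    (fun x => ⟨(x.1, 1), x.2, one_mul 1, by rw [mul_one, one_mul]⟩)
    fun x y h => Subtype.ext (congrArg (fun p : CommutingInvolutions G => p.1.1) h)

end CommutingInvolutions

/-! ### Means and deviations from an approximate product model -/

section UniformMean

theorem uniformMean_eq {Ω : Type*} [Fintype Ω] (X : Ω → ℝ) :
    uniformMean X = (∑ ω, X ω) / (Nat.card Ω : ℝ) := by
  rw [uniformMean, Nat.card_eq_fintype_card]
  congr!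

theorem uniformMean_div {Ω : Type*} [Finite Ω] (X : Ω → ℝ) (M : ℝ) :
    uniformMean (fun ω => X ω / M) = uniformMean X / M := by
  have := Fintype.ofFinite Ω
  rw [uniformMean_eq, uniformMean_eq, ← Finset.sum_div, div_right_comm]

theorem uniformMean_sq_sub {Ω : Type*} [Finite Ω] [Nonempty Ω] (X : Ω → ℝ) :
    uniformMean (fun ω => (X ω - uniformMean X) ^ 2) =
      uniformMean (fun ω => X ω ^ 2) - uniformMean X ^ 2 := by
  have := Fintype.ofFinite Ω
  have hne : (Nat.card Ω : ℝ) ≠ 0 := Nat.cast_ne_zero.2 Nat.card_pos.ne'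
  set μ := uniformMean X with hμ
  have hsum : ∑ ω, X ω = μ * Nat.card Ω := by
    rw [hμ, uniformMean_eq, div_mul_cancel₀ _ hne]
  rw [uniformMean_eq, uniformMean_eq]
  have : ∀ ω, (X ω - μ) ^ 2 = X ω ^ 2 - 2 * μ * X ω + μ ^ 2 := fun ω => by ring
  simp only [this, Finset.sum_add_distrib, Finset.sum_sub_distrib, ← Finset.mul_sum, hsum,
    Finset.sum_const, Finset.card_univ, nsmul_eq_mul, ← Nat.card_eq_fintype_card]
  field_simp
  ring

theorem uniformStdDev_div {Ω : Type*} [Finite Ω] [Nonempty Ω] (X : Ω → ℝ) {M : ℝ} (hM : 0 ≤ M) :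
    uniformStdDev X / M =
      √(uniformMean (fun ω => (X ω / M) ^ 2) - uniformMean (fun ω => X ω / M) ^ 2) := by
  rw [uniformStdDev, uniformMean_sq_sub, uniformMean_div, div_pow]
  simp only [div_pow]
  rw [uniformMean_div, ← sub_div, Real.sqrt_div' _ (sq_nonneg M), Real.sqrt_sq hM]

/-- If, up to a small exceptional set, the sample space is a product with a finite factor `T` and
`Z` is close to a function `c` on `T`, then the mean of `Z` is close to that of `c`. -/
theorem abs_uniformMean_sub_le {Ω Ψ T : Type*} [Finite Ω] [Nonempty Ω] [Finite Ψ] [Fintype T]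
    [Nonempty T] {F : Ψ × T → Ω} (hF : Function.Injective F) {Z : Ω → ℝ}
    (hZ : ∀ ω, Z ω ∈ Set.Icc (0 : ℝ) 1) {c : T → ℝ} (hc : ∀ t, c t ∈ Set.Icc (0 : ℝ) 1) {δ : ℝ}
    (h : ∀ ψ t, |Z (F (ψ, t)) - c t| ≤ δ) (hδ : 0 ≤ δ) {b : ℕ}
    (hb : Nat.card {ω // ω ∉ Set.range F} ≤ b) :
    |uniformMean Z - (∑ t, c t) / (Nat.card T : ℝ)| ≤ b / (Nat.card Ω : ℝ) + δ := by
  classical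
  have := Fintype.ofFinite Ω
  have := Fintype.ofFinite Ψ
  have hne : (0 : ℝ) < (Nat.card Ω : ℝ) := Nat.cast_pos.2 Nat.card_pos
  have hneT : (0 : ℝ) < (Nat.card T : ℝ) := Nat.cast_pos.2 Nat.card_pos
  set m := (∑ t, c t) / (Nat.card T : ℝ) with hm
  -- The deviations of `c` from its mean cancel over each fibre `{ψ} × T`, so only the error `Z - c`
  -- survives on the range of `F`.
  have hcT : ∑ t, (c t - m) = 0 := by
    rw [Finset.sum_sub_distrib, Finset.sum_const, Finset.card_univ, ← Nat.card_eq_fintype_card,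
      nsmul_eq_mul, hm, mul_div_cancel₀ _ hneT.ne', sub_self]
  have hm1 : m ∈ Set.Icc (0 : ℝ) 1 := by
    refine ⟨div_nonneg (Finset.sum_nonneg fun t _ => (hc t).1) hneT.le, ?_⟩
    rw [hm, div_le_one hneT]
    calc ∑ t, c t ≤ ∑ _t : T, (1 : ℝ) := Finset.sum_le_sum fun t _ => (hc t).2
      _ = (Nat.card T : ℝ) := by simp [Nat.card_eq_fintype_card]
  have hsplit : ∑ ω, (Z ω - m) =
      (∑ ω ∈ Finset.univ.image F, (Z ω - m)) +
        ∑ ω ∈ Finset.univ.filter (fun ω => ω ∉ Set.range F), (Z ω - m) := by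
    rw [← Finset.sum_filter_add_sum_filter_not Finset.univ (fun ω => ω ∈ Set.range F)]
    congr 1
    refine Finset.sum_congr (Finset.ext fun ω => ?_) fun _ _ => rfl
    simp
  have hgood : |∑ ω ∈ Finset.univ.image F, (Z ω - m)| ≤ δ * Nat.card Ω := by
    rw [Finset.sum_image hF.injOn, Fintype.sum_prod_type]
    have h1 : ∀ ψ : Ψ, ∑ t, (Z (F (ψ, t)) - m) = ∑ t, (Z (F (ψ, t)) - c t) := fun ψ => by
      rw [← add_zero (∑ t, (Z (F (ψ, t)) - c t)), ← hcT, ← Finset.sum_add_distrib]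
      exact Finset.sum_congr rfl fun t _ => by ring
    simp only [h1]
    rw [← Fintype.sum_prod_type' (f := fun ψ t => Z (F (ψ, t)) - c t)]
    calc _ ≤ ∑ x : Ψ × T, |Z (F (x.1, x.2)) - c x.2| := Finset.abs_sum_le_sum_abs _ _
      _ ≤ ∑ _x : Ψ × T, δ := Finset.sum_le_sum fun x _ => h x.1 x.2
      _ = (Nat.card (Ψ × T) : ℝ) * δ := by
        rw [Finset.sum_const, Finset.card_univ, nsmul_eq_mul, Nat.card_eq_fintype_card]
      _ ≤ (Nat.card Ω : ℝ) * δ := by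
        gcongr
        exact Nat.card_le_card_of_injective F hF
      _ = _ := mul_comm _ _
  have hbad : |∑ ω ∈ Finset.univ.filter (fun ω => ω ∉ Set.range F), (Z ω - m)| ≤ b := by
    calc _ ≤ ∑ ω ∈ Finset.univ.filter (fun ω => ω ∉ Set.range F), |Z ω - m| :=
          Finset.abs_sum_le_sum_abs _ _
      _ ≤ ∑ ω ∈ Finset.univ.filter (fun ω => ω ∉ Set.range F), (1 : ℝ) := by
        refine Finset.sum_le_sum fun ω _ => abs_le.2 ⟨?_, ?_⟩
        · linarith [(hZ ω).1, hm1.2]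
        · linarith [(hZ ω).2, hm1.1]
      _ = (Nat.card {ω // ω ∉ Set.range F} : ℝ) := by
        rw [Finset.sum_const, nsmul_eq_mul, mul_one, Nat.card_eq_fintype_card, Fintype.card_subtype]
      _ ≤ b := by exact_mod_cast hb
  have hmean : uniformMean Z - m = (∑ ω, (Z ω - m)) / Nat.card Ω := by
    rw [uniformMean_eq, Finset.sum_sub_distrib, Finset.sum_const, Finset.card_univ,
      ← Nat.card_eq_fintype_card, nsmul_eq_mul, sub_div, mul_div_cancel_left₀ _ hne.ne']
  rw [hmean, abs_div, abs_of_pos hne, div_le_iff₀ hne, add_mul, div_mul_cancel₀ _ hne.ne', hsplit]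
  exact (abs_add_le _ _).trans (by linarith)

/-- `T` is the set of types, `c` the limiting ratio of each, and the complement of the range of `F`
is negligible against `(d k)!`. Applying the approximation to the ratio and to its square gives the
first two moments, hence the deviation. -/
theorem tendsto_imageOrder_of_model {G : ℕ → Type} [∀ k, Group (G k)] [∀ k, Finite (G k)]
    {T : Type} [Fintype T] [Nonempty T] {c : T → ℝ} (hc : ∀ t, c t ∈ Set.Icc (0 : ℝ) 1)
    {δ : ℕ → ℝ} (hδ0 : ∀ k, 0 ≤ δ k) (hδ : Tendsto δ atTop (nhds 0)) {d : ℕ → ℕ}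
    (hd : Tendsto d atTop atTop) (hcard : ∀ᶠ k in atTop, (d k)! ≤ Nat.card (G k →* G k))
    (H : ∀ᶠ k in atTop, ∃ (Ψ : Type) (_ : Finite Ψ) (F : Ψ × T → (G k →* G k)),
      Function.Injective F ∧
      Nat.card {f // f ∉ Set.range F} ≤ 4 ^ d k * numCommutingInvolutions (d k) ∧
      ∀ ψ t, |imageOrder (F (ψ, t)) / (Nat.card (G k) : ℝ) - c t| ≤ δ k) :
    Tendsto (fun k => expectedImageOrder (G k) / (Nat.card (G k) : ℝ)) atTop
      (nhds ((∑ t, c t) / (Nat.card T : ℝ))) ∧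
    Tendsto (fun k => stdDevImageOrder (G k) / (Nat.card (G k) : ℝ)) atTop
      (nhds √((∑ t, c t ^ 2) / (Nat.card T : ℝ) - ((∑ t, c t) / (Nat.card T : ℝ)) ^ 2)) := by
  set Y : ∀ k, (G k →* G k) → ℝ := fun k f => imageOrder f / (Nat.card (G k) : ℝ) with hY
  have hY01 : ∀ k f, Y k f ∈ Set.Icc (0 : ℝ) 1 := fun k f => by
    refine ⟨by simp only [hY, imageOrder]; positivity, ?_⟩
    refine div_le_one_of_le₀ ?_ (Nat.cast_nonneg _)
    exact Nat.cast_le.2 (Nat.card_le_card_of_injective _ Subtype.val_injective)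
  have hlim : Tendsto (fun k => ((4 ^ d k * numCommutingInvolutions (d k) : ℕ) : ℝ) /
      (Nat.card (G k →* G k) : ℝ)) atTop (nhds 0) := by
    refine squeeze_zero' (Eventually.of_forall fun k => by positivity) ?_
      (tendsto_numCommutingInvolutions.comp hd)
    filter_upwards [hcard] with k hk
    simp only [Function.comp_apply, Nat.cast_mul, Nat.cast_pow, Nat.cast_ofNat]
    have : (0 : ℝ) < ((d k)! : ℝ) := by exact_mod_cast Nat.factorial_pos _
    gcongr
  have hm1 : Tendsto (fun k => uniformMean (Y k)) atTop
      (nhds ((∑ t, c t) / (Nat.card T : ℝ))) := by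
    rw [tendsto_iff_norm_sub_tendsto_zero]
    refine squeeze_zero' (Eventually.of_forall fun k => norm_nonneg _) ?_
      (by have := hlim.add hδ; rwa [add_zero] at this)
    filter_upwards [H] with k ⟨Ψ, _, F, hF, hb, hFc⟩
    exact abs_uniformMean_sub_le hF (hY01 k) hc hFc (hδ0 k) hb
  have hm2 : Tendsto (fun k => uniformMean (fun f => Y k f ^ 2)) atTop
      (nhds ((∑ t, c t ^ 2) / (Nat.card T : ℝ))) := by
    rw [tendsto_iff_norm_sub_tendsto_zero]
    refine squeeze_zero' (Eventually.of_forall fun k => norm_nonneg _) ?_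
      (by have := hlim.add (hδ.const_mul 2); rwa [mul_zero, add_zero] at this)
    filter_upwards [H] with k ⟨Ψ, _, F, hF, hb, hFc⟩
    -- The error doubles because `y² - c² = (y + c)(y - c)` with `y` and `c` in `[0, 1]`.
    refine abs_uniformMean_sub_le (c := fun t => c t ^ 2) (δ := 2 * δ k) hF
      (fun f => ⟨sq_nonneg _, pow_le_one₀ (hY01 k f).1 (hY01 k f).2⟩)
      (fun t => ⟨sq_nonneg _, pow_le_one₀ (hc t).1 (hc t).2⟩) (fun ψ t => ?_)
      (by linarith [hδ0 k]) hb
    have h1 := hY01 k (F (ψ, t))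
    have h2 := hc t
    rw [sq_sub_sq, abs_mul]
    have h3 : |Y k (F (ψ, t)) + c t| ≤ 2 := abs_le.2 ⟨by linarith [h1.1, h2.1], by linarith [h1.2, h2.2]⟩
    exact mul_le_mul h3 (hFc ψ t) (abs_nonneg _) (by norm_num)
  constructor
  · simpa only [expectedImageOrder, ← uniformMean_div] using hm1
  · have : ∀ k, stdDevImageOrder (G k) / (Nat.card (G k) : ℝ) =
        √(uniformMean (fun f => Y k f ^ 2) - uniformMean (Y k) ^ 2) := fun k =>
      uniformStdDev_div _ (Nat.cast_nonneg _)
    simp only [this]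
    exact (hm2.sub (hm1.pow 2)).sqrt

theorem isEquivalent_of_tendsto_div {u v w : ℕ → ℝ} {a : ℝ} (ha : a ≠ 0) (hv : ∀ k, v k ≠ 0)
    (h : Tendsto (fun k => u k / v k) atTop (nhds a)) (hw : ∀ k, w k = a * v k) : u ~[atTop] w := by
  refine (isEquivalent_iff_tendsto_one (Eventually.of_forall fun k => ?_)).2 ?_
  · rw [hw]
    exact mul_ne_zero ha (hv k)
  · have h2 := h.div_const a
    rw [div_self ha] at h2
    refine h2.congr fun k => ?_
    rw [Pi.div_apply, hw, div_div, mul_comm]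

end UniformMean

/-! ### A lower bound for the number of endomorphisms -/

section InnerEndomorphisms

theorem Equiv.Perm.eq_one_of_forall_commute {α : Type*} [Fintype α] [DecidableEq α]
    (hα : 3 ≤ Fintype.card α) {x : Equiv.Perm α} (h : ∀ σ, x * σ = σ * x) : x = 1 := by
  by_contra hx
  obtain ⟨a, ha⟩ : ∃ a, x a ≠ a := by
    by_contra! h
    exact hx (Equiv.ext h)
  obtain ⟨b, hb⟩ := Finset.exists_notMem_of_card_lt ({a, x a} : Finset α)
    (lt_of_le_of_lt Finset.card_le_two (by omega))
  simp only [Finset.mem_insert, Finset.mem_singleton, not_or] at hb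
  have := Equiv.congr_fun (h (Equiv.swap (x a) b)) a
  simp only [Equiv.Perm.mul_apply, Equiv.swap_apply_left,
    Equiv.swap_apply_of_ne_of_ne (Ne.symm ha) (Ne.symm hb.1)] at this
  exact hb.2 this.symm

/-- A finite group that retracts onto a copy of the symmetric group on `n` letters has at least
`n!` endomorphisms. -/
theorem factorial_le_card_end {G : Type*} [Group G] [Finite G] {n : ℕ} (hn : 3 ≤ n)
    (ι : Equiv.Perm (Fin n) →* G) (p : G →* Equiv.Perm (Fin n)) (h : ∀ σ, p (ι σ) = σ) :
    n ! ≤ Nat.card (G →* G) := by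
  have hinj : Function.Injective
      fun σ : Equiv.Perm (Fin n) => (MulAut.conj (ι σ)).toMonoidHom := by
    intro σ τ hστ
    have key : ∀ ρ, σ * ρ * σ⁻¹ = τ * ρ * τ⁻¹ := fun ρ => by
      have := congrArg p (DFunLike.congr_fun hστ (ι ρ))
      simpa [h] using this
    have : τ⁻¹ * σ = 1 := by
      refine Equiv.Perm.eq_one_of_forall_commute (by simpa using hn) fun ρ => ?_
      have := key ρ
      rw [mul_inv_eq_iff_eq_mul] at this
      rw [mul_assoc, this]
      group
    rwa [inv_mul_eq_one, eq_comm] at this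
  have := Nat.card_le_card_of_injective _ hinj
  rwa [Nat.card_eq_fintype_card, Fintype.card_perm, Fintype.card_fin] at this

end InnerEndomorphisms

/-! ### Homomorphisms killing the alternating group, and type A -/

section HomsFromPerm

theorem Equiv.swap_mul_swap_mem_alternatingGroup {α : Type*} [Fintype α] [DecidableEq α]
    {a b c d : α} (hab : a ≠ b) (hcd : c ≠ d) :
    Equiv.swap a b * Equiv.swap c d ∈ alternatingGroup α := by
  rw [Equiv.Perm.mem_alternatingGroup, map_mul, Equiv.Perm.sign_swap hab, Equiv.Perm.sign_swap hcd]
  decide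

/-- A homomorphism that kills the alternating group is determined by its value at any
transposition. -/
theorem monoidHom_perm_ext {α H : Type*} [Fintype α] [DecidableEq α] [Group H]
    {f g : Equiv.Perm α →* H} (hf : ∀ σ ∈ alternatingGroup α, f σ = 1)
    (hg : ∀ σ ∈ alternatingGroup α, g σ = 1) {a b : α} (hab : a ≠ b)
    (h : f (Equiv.swap a b) = g (Equiv.swap a b)) : f = g := by
  have key : ∀ f : Equiv.Perm α →* H, (∀ σ ∈ alternatingGroup α, f σ = 1) → ∀ c d, c ≠ d →
      f (Equiv.swap c d) = f (Equiv.swap a b) := fun f hf c d hcd => by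
    have h1 := hf _ (Equiv.swap_mul_swap_mem_alternatingGroup hcd hab)
    rw [map_mul, mul_eq_one_iff_eq_inv, ← map_inv, Equiv.swap_inv] at h1
    exact h1
  refine MonoidHom.eq_of_eqOn_dense Equiv.Perm.closure_isSwap ?_
  rintro _ ⟨c, d, hcd, rfl⟩
  rw [key f hf c d hcd, key g hg c d hcd, h]

/-- Such an endomorphism is determined by the image of one transposition, an element of order at
most two. -/
theorem card_not_injective_perm_le (n : ℕ) (hn : 5 ≤ n) :
    Nat.card {f : Equiv.Perm (Fin n) →* Equiv.Perm (Fin n) // ¬ Function.Injective f} ≤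
      numCommutingInvolutions n := by
  have h01 : (⟨0, by omega⟩ : Fin n) ≠ ⟨1, by omega⟩ := by simp
  set s := Equiv.swap (⟨0, by omega⟩ : Fin n) ⟨1, by omega⟩ with hs
  let F : {f : Equiv.Perm (Fin n) →* Equiv.Perm (Fin n) // ¬ Function.Injective f} →
      {x : Equiv.Perm (Fin n) // x * x = 1} := fun f =>
    ⟨f.1 s, by rw [← map_mul, hs, Equiv.swap_mul_self, map_one]⟩
  have hF : Function.Injective F := fun f g h =>
    Subtype.ext (monoidHom_perm_ext
      (fun σ hσ => map_eq_one_of_mem_alternatingGroup (by simpa using hn) f.1 f.2 hσ)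
      (fun σ hσ => map_eq_one_of_mem_alternatingGroup (by simpa using hn) g.1 g.2 hσ)
      h01 (congrArg Subtype.val h))
  exact (Nat.card_le_card_of_injective F hF).trans (card_involutions_le _)

theorem tendsto_imageOrder_typeA :
    Tendsto (fun n => expectedImageOrder (TypeA n) / (Nat.card (TypeA n) : ℝ)) atTop (nhds 1) ∧
    Tendsto (fun n => stdDevImageOrder (TypeA n) / (Nat.card (TypeA n) : ℝ)) atTop (nhds 0) := by
  have hd : Tendsto (fun n : ℕ => n + 1) atTop atTop := tendsto_add_atTop_nat 1
  have := tendsto_imageOrder_of_model (G := TypeA) (T := Unit) (c := fun _ => 1) (by simp)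
    (δ := fun _ => 0) (fun _ => le_rfl) tendsto_const_nhds hd ?_ ?_
  · simpa using this
  · filter_upwards [eventually_ge_atTop 2] with n hn
    exact factorial_le_card_end (by omega) (MonoidHom.id _) (MonoidHom.id _) fun _ => rfl
  · filter_upwards [eventually_ge_atTop 4] with n hn
    refine ⟨{f : TypeA n →* TypeA n // Function.Injective f}, inferInstance, fun x => x.1.1,
      fun x y h => Prod.ext (Subtype.ext h) rfl, ?_, fun ψ t => ?_⟩
    · have h1 : ∀ f : TypeA n →* TypeA n, f ∉ Set.range
          (fun x : {f : TypeA n →* TypeA n // Function.Injective f} × Unit => x.1.1) ↔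
          ¬ Function.Injective f := fun f => by simp
      rw [Nat.card_congr (Equiv.subtypeEquivRight h1)]
      exact (card_not_injective_perm_le (n + 1) (by omega)).trans
        (Nat.le_mul_of_pos_left _ (by positivity))
    · have : Nat.card ψ.1.range = Nat.card (TypeA n) :=
        (Nat.card_congr (ψ.1.ofInjective ψ.2).toEquiv).symm
      have hne : (Nat.card (TypeA n) : ℝ) ≠ 0 := Nat.cast_ne_zero.2 Nat.card_pos.ne'
      rw [imageOrder, this, div_self hne, sub_self, abs_zero]

end HomsFromPerm

/-! ### Signed permutations and the extension of homomorphisms to signs -/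

section TypeCBasics

variable {n : ℕ}

theorem typeC_left_mul (a b : TypeC n) (i : Fin n) :
    (a * b).left i = a.left i * b.left (a.right⁻¹ i) := rfl

theorem typeC_conj_inl (w : TypeC n) (u : Fin n → ℤˣ) :
    w * SemidirectProduct.inl u * w⁻¹ = SemidirectProduct.inl fun i => u (w.right⁻¹ i) := by
  rw [mul_inv_eq_iff_eq_mul]
  refine SemidirectProduct.ext (funext fun i => ?_) (by simp)
  simp only [typeC_left_mul, SemidirectProduct.left_inl, SemidirectProduct.right_inl, inv_one,
    Equiv.Perm.one_apply]
  exact mul_comm _ _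

theorem typeC_eq_inl {w : TypeC n} (hw : w.right = 1) : w = SemidirectProduct.inl w.left :=
  SemidirectProduct.ext rfl hw

theorem typeC_mul_self_of_right_eq_one {w : TypeC n} (hw : w.right = 1) : w * w = 1 := by
  rw [typeC_eq_inl hw, ← map_mul, ← map_one SemidirectProduct.inl]
  congr 1
  exact funext fun i => Int.units_mul_self _

/-- An embedding of the symmetric group into the signed permutations remains injective when signs
are forgotten. -/
theorem right_comp_injective (hn : 5 ≤ n) {ψ : Equiv.Perm (Fin n) →* TypeC n}
    (hψ : Function.Injective ψ) :
    Function.Injective ((SemidirectProduct.rightHom : TypeC n →* _).comp ψ) := by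
  by_contra hinj
  have h01 : (⟨0, by omega⟩ : Fin n) ≠ ⟨1, by omega⟩ := by simp
  have h02 : (⟨0, by omega⟩ : Fin n) ≠ ⟨2, by omega⟩ := by simp
  have h12 : (⟨1, by omega⟩ : Fin n) ≠ ⟨2, by omega⟩ := by simp
  have h3 := Equiv.Perm.isThreeCycle_swap_mul_swap_same h01 h02 h12
  have h1 := map_eq_one_of_mem_alternatingGroup (by simpa using hn) _ hinj h3.mem_alternatingGroup
  -- If injectivity failed, a 3-cycle would land among the signs, where squares are trivial.
  have h2 := typeC_mul_self_of_right_eq_one h1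
  rw [← map_mul, ← map_one ψ] at h2
  have h5 := hψ h2
  rw [← sq] at h5
  have h4 := orderOf_dvd_of_pow_eq_one h5
  rw [h3.orderOf] at h4
  omega

theorem exists_right_eq_conj (hn : 7 ≤ n) {ψ : Equiv.Perm (Fin n) →* TypeC n}
    (hψ : Function.Injective ψ) :
    ∃ α : Equiv.Perm (Fin n), ∀ σ, (ψ σ).right = α * σ * α⁻¹ :=
  Equiv.Perm.exists_eq_conj_of_injective (by simpa using hn) _
    (right_comp_injective (by omega) hψ)

/-- A homomorphism onto the permutations maps commutative normal subgroups into the signs. -/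
theorem right_map_eq_one {G : Type*} [Group G] (hn : 5 ≤ n) (f : G →* TypeC n)
    (hf : Function.Surjective ((SemidirectProduct.rightHom : TypeC n →* _).comp f))
    (V : Subgroup G) [V.Normal] (hV : ∀ x ∈ V, ∀ y ∈ V, x * y = y * x) {v : G} (hv : v ∈ V) :
    (f v).right = 1 := by
  set p := (SemidirectProduct.rightHom : TypeC n →* _).comp f
  have : (V.map p).Normal := Subgroup.Normal.map inferInstance p hf
  have hbot := Subgroup.eq_bot_of_normal_of_commute (by simpa using hn) (V.map p) (by
    rintro _ ⟨x, hx, rfl⟩ _ ⟨y, hy, rfl⟩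
    rw [← map_mul, hV x hx y hy, map_mul])
  have h1 : p v ∈ V.map p := Subgroup.mem_map_of_mem p hv
  rw [hbot, Subgroup.mem_bot] at h1
  exact h1

/-- The equivariant endomorphism of the group of sign vectors that multiplies the vector, or the
trivial vector, by the product of the signs, or by `1`. -/
def scalarHom (n : ℕ) (t : Bool × Bool) : (Fin n → ℤˣ) →* (Fin n → ℤˣ) where
  toFun v i := (if t.1 then ∏ j, v j else 1) * (if t.2 then v i else 1)
  map_one' := by
    funext i
    simp
  map_mul' v w := by
    funext i
    simp only [Pi.mul_apply, Finset.prod_mul_distrib]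
    split_ifs <;> simp [mul_mul_mul_comm]

theorem scalarHom_apply (t : Bool × Bool) (v : Fin n → ℤˣ) (i : Fin n) :
    scalarHom n t v i = (if t.1 then ∏ j, v j else 1) * (if t.2 then v i else 1) := rfl

/-- The coordinate permutation as an endomorphism of the group of sign vectors. -/
def reindexHom (α : Equiv.Perm (Fin n)) : (Fin n → ℤˣ) →* (Fin n → ℤˣ) where
  toFun v i := v (α⁻¹ i)
  map_one' := rfl
  map_mul' _ _ := rfl

/-- The endomorphism of `C_n` that extends `ψ` and acts on the signs as `scalarHom`. -/
def extendHom (ψ : Equiv.Perm (Fin n) →* TypeC n) (α : Equiv.Perm (Fin n))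
    (hα : ∀ σ, (ψ σ).right = α * σ * α⁻¹) (t : Bool × Bool) : TypeC n →* TypeC n :=
  SemidirectProduct.lift
    ((SemidirectProduct.inl.comp (reindexHom α)).comp (scalarHom n t)) ψ (by
      intro σ
      ext1 v
      change SemidirectProduct.inl _ = ψ σ * SemidirectProduct.inl _ * (ψ σ)⁻¹
      rw [typeC_conj_inl, hα]
      congr 1
      funext i
      change (if t.1 then ∏ j, v (σ⁻¹ j) else 1) * (if t.2 then v (σ⁻¹ (α⁻¹ i)) else 1) =
        (if t.1 then ∏ j, v j else 1) * (if t.2 then v (α⁻¹ ((α * σ * α⁻¹)⁻¹ i)) else 1)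
      rw [Equiv.prod_comp σ⁻¹ v]
      congr 3
      simp [mul_assoc])

theorem extendHom_apply (ψ : Equiv.Perm (Fin n) →* TypeC n) (α : Equiv.Perm (Fin n))
    (hα : ∀ σ, (ψ σ).right = α * σ * α⁻¹) (t : Bool × Bool) (w : TypeC n) :
    extendHom ψ α hα t w =
      SemidirectProduct.inl (reindexHom α (scalarHom n t w.left)) * ψ w.right := rfl

theorem extendHom_inl (ψ : Equiv.Perm (Fin n) →* TypeC n) (α : Equiv.Perm (Fin n))
    (hα : ∀ σ, (ψ σ).right = α * σ * α⁻¹) (t : Bool × Bool) (v : Fin n → ℤˣ) :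
    extendHom ψ α hα t (SemidirectProduct.inl v) =
      SemidirectProduct.inl (reindexHom α (scalarHom n t v)) := by
  simp [extendHom]

theorem extendHom_inr (ψ : Equiv.Perm (Fin n) →* TypeC n) (α : Equiv.Perm (Fin n))
    (hα : ∀ σ, (ψ σ).right = α * σ * α⁻¹) (t : Bool × Bool) (σ : Equiv.Perm (Fin n)) :
    extendHom ψ α hα t (SemidirectProduct.inr σ) = ψ σ := by
  simp [extendHom]

/-- Conjugation by `α` is injective on the permutation part, so the kernel lies in the signs and is
that of `scalarHom`. -/
theorem extendHom_eq_one_iff (ψ : Equiv.Perm (Fin n) →* TypeC n) (α : Equiv.Perm (Fin n))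
    (hα : ∀ σ, (ψ σ).right = α * σ * α⁻¹) (t : Bool × Bool) (w : TypeC n) :
    extendHom ψ α hα t w = 1 ↔ w.right = 1 ∧ scalarHom n t w.left = 1 := by
  constructor
  · intro h
    have h1 : w.right = 1 := by
      have := congrArg SemidirectProduct.right h
      simp only [extendHom_apply, SemidirectProduct.mul_right, SemidirectProduct.right_inl, one_mul,
        hα, SemidirectProduct.one_right] at this
      rwa [mul_inv_eq_one, mul_eq_left] at this
    refine ⟨h1, ?_⟩
    rw [extendHom_apply, h1, map_one, mul_one, ← map_one SemidirectProduct.inl] at h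
    have h2 := SemidirectProduct.inl_injective h
    funext i
    have := congrFun h2 (α i)
    simpa [reindexHom] using this
  · rintro ⟨h1, h2⟩
    rw [extendHom_apply, h1, h2, map_one, map_one, map_one, one_mul]

theorem card_typeC (n : ℕ) : Nat.card (TypeC n) = 2 ^ n * n ! := by
  rw [SemidirectProduct.card]
  simp [Nat.card_eq_fintype_card, Fintype.card_perm]

/-- Without the identity component, signs can only go to the two constant vectors. -/
theorem card_range_extendHom_le (ψ : Equiv.Perm (Fin n) →* TypeC n) (α : Equiv.Perm (Fin n))
    (hα : ∀ σ, (ψ σ).right = α * σ * α⁻¹) (s : Bool) :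
    Nat.card (extendHom ψ α hα (s, false)).range ≤ 2 * n ! := by
  let F : ℤˣ × Equiv.Perm (Fin n) → TypeC n := fun x =>
    SemidirectProduct.inl (fun _ => if s then x.1 else 1) * ψ x.2
  have hsub : ((extendHom ψ α hα (s, false)).range : Set (TypeC n)) ⊆ Set.range F := by
    rintro _ ⟨w, rfl⟩
    refine ⟨(∏ j, w.left j, w.right), ?_⟩
    rw [extendHom_apply]
    refine congrArg (fun v => SemidirectProduct.inl v * ψ w.right) (funext fun i => ?_)
    simp [reindexHom, scalarHom_apply]
  calc Nat.card (extendHom ψ α hα (s, false)).range ≤ Nat.card (Set.range F) :=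
        Nat.card_mono (Set.toFinite _) hsub
    _ ≤ Nat.card (ℤˣ × Equiv.Perm (Fin n)) := Finite.card_range_le F
    _ = 2 * n ! := by
      simp [Nat.card_eq_fintype_card, Fintype.card_perm]

end TypeCBasics

/-! ### Equivariant endomorphisms of the sign vectors -/

section SignVectors

variable {n : ℕ}

/-- The sign vector whose only negative entry is at `i`. -/
def signAt (i : Fin n) : Fin n → ℤˣ := Pi.mulSingle i (-1)

theorem signAt_apply (i j : Fin n) : signAt i j = if j = i then -1 else 1 := by
  simp [signAt, Pi.mulSingle_apply]

theorem signAt_reindex (σ : Equiv.Perm (Fin n)) (i : Fin n) :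
    (fun j => signAt i (σ⁻¹ j)) = signAt (σ i) := by
  funext j
  simp only [signAt_apply, Equiv.Perm.inv_eq_iff_eq]

theorem prod_signAt (i : Fin n) : ∏ j, signAt i j = -1 := by
  simp only [signAt_apply]
  simp

theorem monoidHom_signs_ext {M : Type*} [Monoid M] {f g : (Fin n → ℤˣ) →* M}
    (h : ∀ i, f (signAt i) = g (signAt i)) : f = g := by
  refine MonoidHom.pi_ext fun i x => ?_
  rcases Int.units_eq_one_or x with rfl | rfl
  · rw [Pi.mulSingle_one, map_one, map_one]
  · exact h i

theorem exists_perm_apply_eq {α : Type*} [DecidableEq α] {x y i k : α} (hxy : x ≠ y)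
    (hik : i ≠ k) : ∃ σ : Equiv.Perm α, σ x = i ∧ σ y = k := by
  refine ⟨Equiv.swap (Equiv.swap x i y) k * Equiv.swap x i, ?_, ?_⟩
  · rw [Equiv.Perm.mul_apply, Equiv.swap_apply_left, Equiv.swap_apply_of_ne_of_ne _ hik]
    intro h
    have := (Equiv.swap x i).injective ((Equiv.swap_apply_left x i).trans h)
    exact hxy this
  · rw [Equiv.Perm.mul_apply, Equiv.swap_apply_left]

/-- The equivariant endomorphisms of the group of sign vectors. -/
theorem exists_eq_scalarHom (hn : 2 ≤ n) (f : (Fin n → ℤˣ) →* (Fin n → ℤˣ))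
    (hf : ∀ (σ : Equiv.Perm (Fin n)) v i, f (fun j => v (σ⁻¹ j)) i = f v (σ⁻¹ i)) :
    ∃ t, f = scalarHom n t := by
  set x : Fin n := ⟨0, by omega⟩
  set y : Fin n := ⟨1, by omega⟩
  have hxy : x ≠ y := by simp [x, y]
  have hσ : ∀ (σ : Equiv.Perm (Fin n)) i k, f (signAt (σ i)) (σ k) = f (signAt i) k := by
    intro σ i k
    rw [← signAt_reindex, hf, Equiv.Perm.inv_def, Equiv.symm_apply_apply]
  have h1 : ∀ i k, i ≠ k → f (signAt i) k = f (signAt x) y := fun i k hik => by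
    obtain ⟨σ, rfl, rfl⟩ := exists_perm_apply_eq hxy hik
    exact hσ _ _ _
  have h2 : ∀ i, f (signAt i) i = f (signAt x) x := fun i => by
    have := hσ (Equiv.swap x i) x x
    rwa [Equiv.swap_apply_left] at this
  -- By double transitivity the matrix has one diagonal and one off-diagonal entry. The latter is
  -- the coefficient of `J`; that of `I` records whether the two differ.
  refine ⟨(decide (f (signAt x) y = -1), decide (f (signAt x) y ≠ f (signAt x) x)),
    monoidHom_signs_ext fun i => funext fun k => ?_⟩
  rw [scalarHom_apply, prod_signAt, signAt_apply]
  rcases eq_or_ne k i with rfl | hki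
  · rw [h2, if_pos rfl]
    rcases Int.units_eq_one_or (f (signAt x) y) with ha | ha <;>
      rcases Int.units_eq_one_or (f (signAt x) x) with hb | hb <;> rw [ha, hb] <;> decide
  · rw [h1 i k hki.symm, if_neg hki]
    rcases Int.units_eq_one_or (f (signAt x) y) with ha | ha <;> rw [ha] <;> simp

theorem scalarHom_injective (hn : 2 ≤ n) : Function.Injective (scalarHom n) := by
  intro s t h
  have hxy : (⟨1, by omega⟩ : Fin n) ≠ ⟨0, by omega⟩ := by simp
  have h1 := congrFun (DFunLike.congr_fun h (signAt ⟨0, by omega⟩)) ⟨1, by omega⟩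
  have h2 := congrFun (DFunLike.congr_fun h (signAt ⟨0, by omega⟩)) ⟨0, by omega⟩
  rw [scalarHom_apply, scalarHom_apply, prod_signAt, signAt_apply, if_neg hxy] at h1
  rw [scalarHom_apply, scalarHom_apply, prod_signAt, signAt_apply, if_pos rfl] at h2
  obtain ⟨s1, s2⟩ := s
  obtain ⟨t1, t2⟩ := t
  clear h hxy
  revert h1 h2
  revert s1 s2 t1 t2
  decide

end SignVectors

/-! ### Endomorphisms of type C -/

section TypeC

variable {n : ℕ}

open SemidirectProduct in
/-- Endomorphisms of `C_n` that are injective on permutations arise from `extendHom`. -/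
theorem eq_extendHom_of_injective (hn : 7 ≤ n) (f : TypeC n →* TypeC n)
    (α : Equiv.Perm (Fin n)) (hα : ∀ σ, (f.comp inr σ).right = α * σ * α⁻¹) :
    ∃ t, f = extendHom (f.comp inr) α hα t := by
  have hnormal : (inl : (Fin n → ℤˣ) →* TypeC n).range.Normal := by
    rw [range_inl_eq_ker_rightHom]
    infer_instance
  have hright : ∀ v : Fin n → ℤˣ, (f (inl v)).right = 1 := fun v => by
    refine right_map_eq_one (by omega) f (fun τ => ⟨inr (α⁻¹ * τ * α), ?_⟩)
      (inl : (Fin n → ℤˣ) →* TypeC n).range ?_ ⟨v, rfl⟩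
    · refine (hα _).trans ?_
      group
    · rintro _ ⟨v, rfl⟩ _ ⟨w, rfl⟩
      rw [← map_mul, mul_comm, map_mul]
  -- Reading the coordinates through `α` turns equivariance twisted by conjugation into plain
  -- equivariance.
  let L : (Fin n → ℤˣ) →* (Fin n → ℤˣ) :=
    { toFun := fun v i => (f (inl v)).left (α i)
      map_one' := by
        funext i
        simp
      map_mul' := fun v w => by
        funext i
        rw [map_mul, map_mul, typeC_left_mul, hright]
        rfl }
  have hL : ∀ (v : Fin n → ℤˣ), f (inl v) = inl (reindexHom α (L v)) := fun v => by
    rw [typeC_eq_inl (hright v)]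
    refine congrArg inl (funext fun i => ?_)
    change _ = (f (inl v)).left (α (α⁻¹ i))
    rw [Equiv.Perm.inv_def, Equiv.apply_symm_apply]
  obtain ⟨t, ht⟩ := exists_eq_scalarHom (by omega) L (fun σ v i => by
    have h1 : (inl fun j => v (σ⁻¹ j) : TypeC n) = inr σ * inl v * (inr σ)⁻¹ := by
      rw [typeC_conj_inl, right_inr]
    change (f (inl fun j => v (σ⁻¹ j))).left (α i) = (f (inl v)).left (α (σ⁻¹ i))
    rw [h1, map_mul, map_mul, map_inv, typeC_eq_inl (hright v), typeC_conj_inl]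
    have h2 : (f (inr σ)).right = α * σ * α⁻¹ := hα σ
    rw [h2, left_inl, left_inl]
    simp [mul_assoc])
  refine ⟨t, hom_ext (MonoidHom.ext fun v => ?_) (MonoidHom.ext fun σ => ?_)⟩
  · change f (inl v) = extendHom _ α hα t (inl v)
    rw [extendHom_inl, hL, ht]
  · exact (extendHom_inr _ α hα t σ).symm

theorem exists_mem_alternatingGroup_apply_eq {n : ℕ} (hn : 3 ≤ n) {i k : Fin n} (hik : i ≠ k) :
    ∃ σ ∈ alternatingGroup (Fin n), σ i = k := by
  obtain ⟨j, hj⟩ := Finset.exists_notMem_of_card_lt ({i, k} : Finset (Fin n))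
    (lt_of_le_of_lt Finset.card_le_two (by simp; omega))
  simp only [Finset.mem_insert, Finset.mem_singleton, not_or] at hj
  refine ⟨_, Equiv.swap_mul_swap_mem_alternatingGroup (Ne.symm hj.1) hik, ?_⟩
  rw [Equiv.Perm.mul_apply, Equiv.swap_apply_left,
    Equiv.swap_apply_of_ne_of_ne hik.symm (Ne.symm hj.2)]

-- The alternating group permutes the coordinates transitively, and conjugation by elements that `f`
-- kills does not change the image.
open SemidirectProduct in
theorem map_signAt_eq {n : ℕ} (hn : 3 ≤ n) {H : Type*} [Group H] (f : TypeC n →* H)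
    (hf : ∀ σ ∈ alternatingGroup (Fin n), f (inr σ) = 1) (i k : Fin n) :
    f (inl (signAt i)) = f (inl (signAt k)) := by
  rcases eq_or_ne i k with rfl | hik
  · rfl
  obtain ⟨σ, hσ, rfl⟩ := exists_mem_alternatingGroup_apply_eq hn hik
  have h1 : (inl (signAt (σ i)) : TypeC n) = inr σ * inl (signAt i) * (inr σ)⁻¹ := by
    rw [typeC_conj_inl, right_inr, signAt_reindex]
  rw [h1, map_mul, map_mul, map_inv, hf σ hσ, one_mul, inv_one, mul_one]

open SemidirectProduct in
theorem card_not_injective_typeC_le (hn : 5 ≤ n) :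
    Nat.card {f : TypeC n →* TypeC n // ¬ Function.Injective (f.comp inr)} ≤
      4 ^ n * numCommutingInvolutions n := by
  refine le_trans ?_ (card_commutingInvolutions_typeC_le n)
  set x : Fin n := ⟨0, by omega⟩ with hx
  set y : Fin n := ⟨1, by omega⟩ with hy
  -- The coordinate `z` avoids the transposed pair, so its sign change commutes with the
  -- transposition.
  set z : Fin n := ⟨2, by omega⟩ with hz
  have hxy : x ≠ y := by simp [x, y]
  have hzx : z ≠ x := by simp [x, z]
  have hzy : z ≠ y := by simp [y, z]
  have hcomm : (inr (Equiv.swap x y) * inl (signAt z) : TypeC n) =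
      inl (signAt z) * inr (Equiv.swap x y) := by
    rw [← mul_inv_eq_iff_eq_mul, typeC_conj_inl, right_inr, signAt_reindex,
      Equiv.swap_apply_of_ne_of_ne hzx hzy]
  have hkill : ∀ f : {f : TypeC n →* TypeC n // ¬ Function.Injective (f.comp inr)},
      ∀ σ ∈ alternatingGroup (Fin n), f.1.comp inr σ = 1 := fun f σ hσ =>
    map_eq_one_of_mem_alternatingGroup (by simpa using hn) _ f.2 hσ
  let F : {f : TypeC n →* TypeC n // ¬ Function.Injective (f.comp inr)} →
      CommutingInvolutions (TypeC n) := fun f =>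
    ⟨(f.1 (inr (Equiv.swap x y)), f.1 (inl (signAt z))),
      by rw [← map_mul, ← map_mul, Equiv.swap_mul_self, map_one, map_one],
      by rw [← map_mul, typeC_mul_self_of_right_eq_one (right_inl _), map_one],
      by rw [← map_mul, ← map_mul, hcomm]⟩
  refine Nat.card_le_card_of_injective F fun f g h => ?_
  have h1 : f.1 (inr (Equiv.swap x y)) = g.1 (inr (Equiv.swap x y)) :=
    congrArg (fun p => p.1.1) h
  have h2 : f.1 (inl (signAt z)) = g.1 (inl (signAt z)) := congrArg (fun p => p.1.2) h
  refine Subtype.ext (hom_ext (monoidHom_signs_ext fun i => ?_)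
    (monoidHom_perm_ext (hkill f) (hkill g) hxy h1))
  change f.1 (inl (signAt i)) = g.1 (inl (signAt i))
  rw [map_signAt_eq (by omega) f.1 (hkill f) i z, map_signAt_eq (by omega) g.1 (hkill g) i z, h2]

/-- The limiting relative size of the image of `extendHom`. -/
noncomputable def imageRatio (even : Bool) (t : Bool × Bool) : ℝ :=
  if t.2 then (if t.1 && !even then 1 / 2 else 1) else 0

theorem imageOrder_div_of_injective {G : Type*} [Group G] [Finite G] {f : G →* G}
    (hf : Function.Injective f) : imageOrder f / (Nat.card G : ℝ) = 1 := by
  rw [imageOrder, ← Nat.card_congr (f.ofInjective hf).toEquiv]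
  exact div_self (Nat.cast_ne_zero.2 Nat.card_pos.ne')

theorem card_range_mul_card_ker {G H : Type*} [Group G] [Group H] (f : G →* H) :
    Nat.card f.range * Nat.card f.ker = Nat.card G := by
  rw [← Subgroup.index_ker, Subgroup.index_mul_card]

/-- A vector killed by `I + J` has every entry equal to the product of all entries. It is constant,
and `-1` is consistent only when `(-1) ^ n = -1`. -/
theorem scalarHom_true_eq_one_iff (s : Bool) (v : Fin n → ℤˣ) :
    scalarHom n (s, true) v = 1 ↔ v = 1 ∨ (s = true ∧ Odd n ∧ v = fun _ => -1) := by
  constructor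
  · intro h
    have h1 : ∀ i, (if s then ∏ j, v j else 1) * v i = 1 := fun i => congrFun h i
    rcases Bool.eq_false_or_eq_true s with rfl | rfl
    · simp only [if_true] at h1
      have h2 : ∀ i, v i = ∏ j, v j := fun i => by
        rw [← Int.units_inv_eq_self (∏ j, v j), eq_comm, inv_eq_iff_mul_eq_one]
        exact h1 i
      rcases Int.units_eq_one_or (∏ j, v j) with hp | hp
      · left
        funext i
        rw [h2, hp]; rfl
      · right
        have hv : v = fun _ => -1 := funext fun i => by rw [h2, hp]
        refine ⟨rfl, ?_, hv⟩
        rw [hv, Finset.prod_const, Finset.card_univ, Fintype.card_fin] at hp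
        by_contra hodd
        rw [Nat.not_odd_iff_even] at hodd
        rw [hodd.neg_one_pow] at hp
        exact absurd hp (by decide)
    · left
      funext i
      simpa using h1 i
  · rintro (rfl | ⟨rfl, hodd, rfl⟩)
    · exact map_one _
    · funext i
      rw [scalarHom_apply, Finset.prod_const, Finset.card_univ, Fintype.card_fin, hodd.neg_one_pow]
      rfl

theorem card_ker_extendHom_of_odd (hn : Odd n) (ψ : Equiv.Perm (Fin n) →* TypeC n)
    (α : Equiv.Perm (Fin n)) (hα : ∀ σ, (ψ σ).right = α * σ * α⁻¹) :
    Nat.card (extendHom ψ α hα (true, true)).ker = 2 := by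
  have hker : ((extendHom ψ α hα (true, true)).ker : Set (TypeC n)) =
      {1, SemidirectProduct.inl fun _ => -1} := by
    ext w
    rw [SetLike.mem_coe, MonoidHom.mem_ker, extendHom_eq_one_iff, scalarHom_true_eq_one_iff]
    simp only [hn, true_and, Set.mem_insert_iff, Set.mem_singleton_iff, SemidirectProduct.ext_iff,
      SemidirectProduct.one_left, SemidirectProduct.one_right, SemidirectProduct.left_inl,
      SemidirectProduct.right_inl]
    tauto
  have hne : (1 : TypeC n) ≠ SemidirectProduct.inl fun _ => -1 := fun h => by
    have : (1 : ℤˣ) = -1 := congrFun (congrArg SemidirectProduct.left h) ⟨0, hn.pos⟩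
    exact absurd this (by decide)
  have : Nat.card ((extendHom ψ α hα (true, true)).ker : Set (TypeC n)) = 2 := by
    rw [hker, Nat.card_coe_set_eq, Set.ncard_pair hne]
  exact this

theorem abs_imageOrder_extendHom_sub_le {even : Bool} (hn : (even = true) ↔ Even n)
    (ψ : Equiv.Perm (Fin n) →* TypeC n) (α : Equiv.Perm (Fin n))
    (hα : ∀ σ, (ψ σ).right = α * σ * α⁻¹) (t : Bool × Bool) :
    |imageOrder (extendHom ψ α hα t) / (Nat.card (TypeC n) : ℝ) - imageRatio even t| ≤
      4 / 2 ^ n := by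
  have hδ : (0 : ℝ) ≤ 4 / 2 ^ n := by positivity
  obtain ⟨s, t⟩ := t
  cases t with
  | false =>
    have hf : (0 : ℝ) < (n ! : ℝ) := by exact_mod_cast Nat.factorial_pos n
    simp only [imageRatio, Bool.false_eq_true, if_false, sub_zero]
    rw [abs_of_nonneg (by rw [imageOrder]; positivity), card_typeC, imageOrder]
    calc (Nat.card (extendHom ψ α hα (s, false)).range : ℝ) / ((2 ^ n * n ! : ℕ) : ℝ)
        ≤ ((2 * n ! : ℕ) : ℝ) / ((2 ^ n * n ! : ℕ) : ℝ) := by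
          gcongr
          exact card_range_extendHom_le ψ α hα s
      _ = 2 / 2 ^ n := by
          push_cast
          field_simp
      _ ≤ 4 / 2 ^ n := by gcongr; norm_num
  | true =>
    by_cases h : s = true ∧ even = false
    · obtain ⟨rfl, rfl⟩ := h
      have hodd : Odd n := by
        rw [← Nat.not_even_iff_odd, ← hn]; simp
      have h1 := card_range_mul_card_ker (extendHom ψ α hα (true, true))
      rw [card_ker_extendHom_of_odd hodd] at h1
      have h2 : (Nat.card (extendHom ψ α hα (true, true)).range : ℝ) ≠ 0 :=
        Nat.cast_ne_zero.2 Nat.card_pos.ne'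
      rw [imageOrder, ← h1]
      have h3 : imageRatio false (true, true) = 1 / 2 := by simp [imageRatio]
      rw [h3]
      push_cast
      rw [div_mul_cancel_left₀ h2]
      simpa using hδ
    · have hinj : Function.Injective (extendHom ψ α hα (s, true)) := by
        refine (injective_iff_map_eq_one _).2 fun w hw => ?_
        rw [extendHom_eq_one_iff, scalarHom_true_eq_one_iff] at hw
        rcases hw with ⟨hr, hl | ⟨rfl, hodd, -⟩⟩
        · exact SemidirectProduct.ext hl hr
        · refine absurd ⟨rfl, ?_⟩ h
          rw [← Nat.not_even_iff_odd, ← hn] at hodd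
          simpa using hodd
      have h3 : imageRatio even (s, true) = 1 := by
        cases s <;> cases even <;> simp_all [imageRatio]
      rw [imageOrder_div_of_injective hinj, h3, sub_self, abs_zero]
      exact hδ

theorem tendsto_four_div_two_pow : Tendsto (fun n : ℕ => (4 : ℝ) / 2 ^ n) atTop (nhds 0) :=
  tendsto_const_nhds.div_atTop (tendsto_pow_atTop_atTop_of_one_lt (by norm_num))

open SemidirectProduct in
theorem tendsto_imageOrder_typeC {d : ℕ → ℕ} (hd : Tendsto d atTop atTop) {even : Bool}
    (he : ∀ k, (even = true) ↔ Even (d k)) :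
    Tendsto (fun k => expectedImageOrder (TypeC (d k)) / (Nat.card (TypeC (d k)) : ℝ)) atTop
      (nhds ((∑ t, imageRatio even t) / (Nat.card (Bool × Bool) : ℝ))) ∧
    Tendsto (fun k => stdDevImageOrder (TypeC (d k)) / (Nat.card (TypeC (d k)) : ℝ)) atTop
      (nhds √((∑ t, imageRatio even t ^ 2) / (Nat.card (Bool × Bool) : ℝ) -
        ((∑ t, imageRatio even t) / (Nat.card (Bool × Bool) : ℝ)) ^ 2)) := by
  refine tendsto_imageOrder_of_model (fun t => ?_) (δ := fun k => 4 / 2 ^ d k)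
    (fun k => by positivity) (tendsto_four_div_two_pow.comp hd) hd ?_ ?_
  · rw [imageRatio]
    split_ifs <;> norm_num
  · filter_upwards [hd.eventually_ge_atTop 3] with k hk
    exact factorial_le_card_end hk inr rightHom fun σ => by simp
  · filter_upwards [hd.eventually_ge_atTop 7] with k hk
    -- The first factor of the model is the set of embeddings of permutations into `C_n`, each with
    -- a chosen conjugator.
    choose α hα using fun ψ : {ψ : Equiv.Perm (Fin (d k)) →* TypeC (d k) // Function.Injective ψ} =>
      exists_right_eq_conj hk ψ.2
    have : Finite (Equiv.Perm (Fin (d k)) →* TypeC (d k)) :=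
      Finite.of_injective _ DFunLike.coe_injective
    let F : {ψ : Equiv.Perm (Fin (d k)) →* TypeC (d k) // Function.Injective ψ} × (Bool × Bool) →
        (TypeC (d k) →* TypeC (d k)) := fun x => extendHom x.1.1 (α x.1) (hα x.1) x.2
    have hmem : ∀ f, f ∉ Set.range F → ¬ Function.Injective (f.comp inr) := fun f hf hinj => by
      obtain ⟨t, ht⟩ := eq_extendHom_of_injective hk f (α ⟨_, hinj⟩) (hα ⟨_, hinj⟩)
      exact hf ⟨(⟨_, hinj⟩, t), ht.symm⟩
    refine ⟨_, inferInstance, F, ?_, ?_, fun ψ t =>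
      abs_imageOrder_extendHom_sub_le (he k) ψ.1 (α ψ) (hα ψ) t⟩
    · rintro ⟨ψ, s⟩ ⟨ψ', t⟩ h
      have h1 : ψ = ψ' := Subtype.ext (MonoidHom.ext fun σ => by
        have := DFunLike.congr_fun h (inr σ)
        simpa only [F, extendHom_inr] using this)
      subst h1
      refine Prod.ext rfl (scalarHom_injective (n := d k) (by omega) (MonoidHom.ext fun v => ?_))
      have h2 := DFunLike.congr_fun h (inl v)
      simp only [F, extendHom_inl] at h2
      have h3 := inl_injective h2
      funext i
      have h4 := congrFun h3 (α ψ i)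
      simpa [reindexHom] using h4
    · exact le_trans (Nat.card_le_card_of_injective
        (fun f : {f // f ∉ Set.range F} =>
          (⟨f.1, hmem f.1 f.2⟩ : {f : TypeC (d k) →* TypeC (d k) // ¬ Function.Injective (f.comp inr)}))
        fun f g h => Subtype.ext (Subtype.mk.inj h))
        (card_not_injective_typeC_le (n := d k) (by omega))

end TypeC

/-! ### Even sign vectors -/

section EvenSigns

variable {n : ℕ}

/-- The product of the entries of a sign vector. -/
def signProd (n : ℕ) : (Fin n → ℤˣ) →* ℤˣ where
  toFun v := ∏ i, v i
  map_one' := by simp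
  map_mul' v w := by simp [Finset.prod_mul_distrib]

/-- The sign vectors with an even number of negative entries. -/
def evenSigns (n : ℕ) : Subgroup (Fin n → ℤˣ) := (signProd n).ker

theorem signProd_signAt (i : Fin n) : signProd n (signAt i) = -1 := prod_signAt i

/-- The sign vector whose negative entries are at `i` and `j`. -/
def pairSign (i j : Fin n) : evenSigns n :=
  ⟨signAt i * signAt j, by
    rw [evenSigns, MonoidHom.mem_ker, map_mul, signProd_signAt, signProd_signAt]
    rfl⟩

theorem pairSign_comm (i j : Fin n) : pairSign i j = pairSign j i :=
  Subtype.ext (mul_comm _ _)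

theorem signAt_mul_self (i : Fin n) : signAt i * signAt i = 1 :=
  funext fun _ => Int.units_mul_self _

theorem pairSign_self (i : Fin n) : pairSign i i = 1 := Subtype.ext (signAt_mul_self i)

theorem pairSign_mul_pairSign (i j k : Fin n) :
    pairSign i j * pairSign j k = pairSign i k := by
  refine Subtype.ext ?_
  change signAt i * signAt j * (signAt j * signAt k) = signAt i * signAt k
  rw [mul_assoc, ← mul_assoc (signAt j), signAt_mul_self, one_mul]

/-- The retraction of the sign vectors onto the even ones that adjusts the sign at `o`. -/
def evenRetract (o : Fin n) : (Fin n → ℤˣ) →* evenSigns n where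
  toFun v := ⟨v * Pi.mulSingle o (signProd n v), by
    rw [evenSigns, MonoidHom.mem_ker, map_mul]
    have : signProd n (Pi.mulSingle o (signProd n v)) = signProd n v :=
      Fintype.prod_pi_mulSingle' o _
    rw [this, Int.units_mul_self]⟩
  map_one' := Subtype.ext (by simp)
  map_mul' v w := Subtype.ext (by
    change v * w * _ = v * _ * (w * _)
    rw [map_mul, Pi.mulSingle_mul, mul_mul_mul_comm])

theorem evenRetract_signAt (o i : Fin n) : evenRetract o (signAt i) = pairSign i o := by
  refine Subtype.ext ?_
  change signAt i * Pi.mulSingle o (signProd n (signAt i)) = _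
  rw [signProd_signAt]
  rfl

theorem evenRetract_coe (o : Fin n) (v : evenSigns n) : evenRetract o v = v := by
  refine Subtype.ext ?_
  change v.1 * Pi.mulSingle o (signProd n v) = _
  rw [show signProd n v = 1 from v.2, Pi.mulSingle_one, mul_one]

theorem monoidHom_evenSigns_ext {M : Type*} [Monoid M] {f g : evenSigns n →* M} (o : Fin n)
    (h : ∀ i, i ≠ o → f (pairSign i o) = g (pairSign i o)) : f = g := by
  have h1 : f.comp (evenRetract o) = g.comp (evenRetract o) := monoidHom_signs_ext fun i => by
    rw [MonoidHom.comp_apply, MonoidHom.comp_apply, evenRetract_signAt]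
    rcases eq_or_ne i o with rfl | hi
    · rw [pairSign_self, map_one, map_one]
    · exact h i hi
  ext1 v
  have := DFunLike.congr_fun h1 v.1
  rwa [MonoidHom.comp_apply, MonoidHom.comp_apply, evenRetract_coe] at this

/-- The equivariant homomorphisms from the even sign vectors to the sign vectors. -/
theorem exists_eq_scalarHom_comp_subtype (hn : 4 ≤ n) (f : evenSigns n →* (Fin n → ℤˣ))
    (hf : ∀ (σ : Equiv.Perm (Fin n)) i j k,
      f (pairSign (σ i) (σ j)) (σ k) = f (pairSign i j) k) :
    ∃ t, f = (scalarHom n (false, t)).comp (evenSigns n).subtype := by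
  set o : Fin n := ⟨0, by omega⟩
  set a : Fin n := ⟨1, by omega⟩
  have hoa : a ≠ o := by simp [a, o]
  -- Off-diagonal entries are trivial: by equivariance the pairs `i j`, `j l`, `i l` have the same
  -- entry at `k`, and the first two multiply to the third. The auxiliary `l` is why four letters
  -- are needed.
  have hb : ∀ i j k, i ≠ j → k ≠ i → k ≠ j → f (pairSign i j) k = 1 := by
    intro i j k hij hki hkj
    obtain ⟨l, hl⟩ := Finset.exists_notMem_of_card_lt ({i, j, k} : Finset (Fin n))
      (lt_of_le_of_lt Finset.card_le_three (by simp; omega))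
    simp only [Finset.mem_insert, Finset.mem_singleton, not_or] at hl
    obtain ⟨hli, hlj, hlk⟩ := hl
    have h1 : f (pairSign j l) k = f (pairSign i j) k := by
      have := hf (Equiv.swap i l) i j k
      rw [Equiv.swap_apply_left, Equiv.swap_apply_of_ne_of_ne hij.symm (Ne.symm hlj),
        Equiv.swap_apply_of_ne_of_ne hki (Ne.symm hlk)] at this
      rw [← this, pairSign_comm]
    have h2 : f (pairSign i l) k = f (pairSign i j) k := by
      have := hf (Equiv.swap j l) i j k
      rwa [Equiv.swap_apply_left, Equiv.swap_apply_of_ne_of_ne hij (Ne.symm hli),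
        Equiv.swap_apply_of_ne_of_ne hkj (Ne.symm hlk)] at this
    have h3 : f (pairSign i j) k * f (pairSign j l) k = f (pairSign i l) k := by
      rw [← pairSign_mul_pairSign i j l, map_mul, Pi.mul_apply]
    rwa [h1, h2, mul_eq_left] at h3
  have ho : ∀ i, i ≠ o → f (pairSign i o) o = f (pairSign a o) o := by
    intro i hi
    have := hf (Equiv.swap a i) a o o
    rw [Equiv.swap_apply_left, Equiv.swap_apply_of_ne_of_ne hoa.symm hi.symm] at this
    exact this
  have hi : ∀ i, i ≠ o → f (pairSign i o) i = f (pairSign a o) o := by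
    intro i hi
    have := hf (Equiv.swap i o) i o o
    rw [Equiv.swap_apply_left, Equiv.swap_apply_right, pairSign_comm] at this
    rw [this, ho i hi]
  refine ⟨decide (f (pairSign a o) o = -1), monoidHom_evenSigns_ext o fun i hio => funext fun k => ?_⟩
  change _ = 1 * (if decide (f (pairSign a o) o = -1) = true then signAt i k * signAt o k else 1)
  rw [one_mul, signAt_apply, signAt_apply]
  rcases eq_or_ne k i with rfl | hki
  · rw [hi k hio, if_pos rfl, if_neg hio]
    rcases Int.units_eq_one_or (f (pairSign a o) o) with h | h <;> rw [h] <;> simp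
  rcases eq_or_ne k o with rfl | hko
  · rw [ho i hio, if_pos rfl, if_neg hki]
    rcases Int.units_eq_one_or (f (pairSign a o) o) with h | h <;> rw [h] <;> simp
  · rw [hb i o k hio hki hko, if_neg hki, if_neg hko, one_mul, ite_self]

end EvenSigns

/-! ### Endomorphisms of type D -/

section TypeD

variable {n : ℕ}

theorem mem_evenInversions_iff (w : TypeC n) : w ∈ evenInversions n ↔ signProd n w.left = 1 :=
  Iff.rfl

/-- The inclusion of the even sign vectors in `D_n`. -/
def evenInl (n : ℕ) : evenSigns n →* TypeD n :=
  (SemidirectProduct.inl.comp (evenSigns n).subtype).codRestrict (evenInversions n) fun v => v.2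

/-- The inclusion of the permutations in `D_n`. -/
def evenInr (n : ℕ) : Equiv.Perm (Fin n) →* TypeD n :=
  SemidirectProduct.inr.codRestrict (evenInversions n) fun _ => map_one (signProd n)

theorem evenInl_mul_evenInr (w : TypeD n) :
    evenInl n ⟨w.1.left, w.2⟩ * evenInr n w.1.right = w :=
  Subtype.ext (SemidirectProduct.inl_left_mul_inr_right w.1)

theorem typeD_hom_ext {H : Type*} [Group H] {f g : TypeD n →* H}
    (hl : f.comp (evenInl n) = g.comp (evenInl n)) (hr : f.comp (evenInr n) = g.comp (evenInr n)) :
    f = g := by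
  ext1 w
  rw [← evenInl_mul_evenInr w, map_mul, map_mul]
  exact congrArg₂ _ (DFunLike.congr_fun hl _) (DFunLike.congr_fun hr _)

theorem evenInl_pairSign (σ : Equiv.Perm (Fin n)) (i j : Fin n) :
    evenInl n (pairSign (σ i) (σ j)) =
      evenInr n σ * evenInl n (pairSign i j) * (evenInr n σ)⁻¹ := by
  refine Subtype.ext ?_
  change SemidirectProduct.inl (signAt (σ i) * signAt (σ j)) = SemidirectProduct.inr σ *
    SemidirectProduct.inl (signAt i * signAt j) * (SemidirectProduct.inr σ)⁻¹
  rw [typeC_conj_inl, SemidirectProduct.right_inr, ← signAt_reindex, ← signAt_reindex]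
  rfl

/-- Endomorphisms of `D_n` that are injective on permutations arise from `extendHom`. -/
theorem eq_extendHom_of_typeD (hn : 7 ≤ n) (f : TypeD n →* TypeC n)
    (α : Equiv.Perm (Fin n)) (hα : ∀ σ, (f.comp (evenInr n) σ).right = α * σ * α⁻¹) :
    ∃ t, f = (extendHom (f.comp (evenInr n)) α hα (false, t)).comp (evenInversions n).subtype := by
  let V : Subgroup (TypeD n) :=
    ((SemidirectProduct.rightHom : TypeC n →* _).comp (evenInversions n).subtype).ker
  have hright : ∀ v, (f (evenInl n v)).right = 1 := fun v => by
    refine right_map_eq_one (by omega) f (fun τ => ⟨evenInr n (α⁻¹ * τ * α), ?_⟩) V ?_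
      (show SemidirectProduct.right (evenInl n v).1 = 1 from rfl)
    · refine (hα _).trans ?_
      group
    · intro x hx y hy
      have hx' : x.1 = SemidirectProduct.inl x.1.left := typeC_eq_inl hx
      have hy' : y.1 = SemidirectProduct.inl y.1.left := typeC_eq_inl hy
      refine Subtype.ext ?_
      change x.1 * y.1 = y.1 * x.1
      rw [hx', hy', ← map_mul, mul_comm, map_mul]
  let L : evenSigns n →* (Fin n → ℤˣ) :=
    { toFun := fun v i => (f (evenInl n v)).left (α i)
      map_one' := by
        funext i
        simp
      map_mul' := fun v w => by
        funext i
        rw [map_mul, map_mul, typeC_left_mul, hright]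
        rfl }
  have hL : ∀ v, f (evenInl n v) = SemidirectProduct.inl (reindexHom α (L v)) := fun v => by
    rw [typeC_eq_inl (hright v)]
    refine congrArg SemidirectProduct.inl (funext fun i => ?_)
    change _ = (f (evenInl n v)).left (α (α⁻¹ i))
    rw [Equiv.Perm.inv_def, Equiv.apply_symm_apply]
  obtain ⟨t, ht⟩ := exists_eq_scalarHom_comp_subtype (by omega) L (fun σ i j k => by
    change (f (evenInl n (pairSign (σ i) (σ j)))).left (α (σ k)) =
      (f (evenInl n (pairSign i j))).left (α k)
    rw [evenInl_pairSign, map_mul, map_mul, map_inv, typeC_eq_inl (hright (pairSign i j)),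
      typeC_conj_inl]
    have h2 : (f (evenInr n σ)).right = α * σ * α⁻¹ := hα σ
    rw [h2, SemidirectProduct.left_inl, SemidirectProduct.left_inl]
    simp [mul_assoc])
  refine ⟨t, typeD_hom_ext (MonoidHom.ext fun v => ?_) (MonoidHom.ext fun σ => ?_)⟩
  · change f (evenInl n v) = extendHom _ α hα (false, t) (SemidirectProduct.inl v.1)
    rw [extendHom_inl, hL, ht]
    rfl
  · exact (extendHom_inr _ α hα _ σ).symm

theorem extendHom_mem_evenInversions {ψ : Equiv.Perm (Fin n) →* TypeC n}
    (hψ : ∀ σ, ψ σ ∈ evenInversions n) (α : Equiv.Perm (Fin n))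
    (hα : ∀ σ, (ψ σ).right = α * σ * α⁻¹) (t : Bool) {w : TypeC n} (hw : w ∈ evenInversions n) :
    extendHom ψ α hα (false, t) w ∈ evenInversions n := by
  rw [extendHom_apply]
  refine mul_mem ?_ (hψ _)
  rw [mem_evenInversions_iff, SemidirectProduct.left_inl]
  refine (Equiv.prod_comp α⁻¹ (scalarHom n (false, t) w.left)).trans ?_
  cases t
  · simp [scalarHom_apply]
  · have : ∏ i, w.left i = 1 := hw
    simpa [scalarHom_apply] using this

/-- The endomorphism of `D_n` that extends `ψ` and is trivial, or a permutation of the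
coordinates, on the signs. -/
def extendHomD (ψ : Equiv.Perm (Fin n) →* TypeD n) (α : Equiv.Perm (Fin n))
    (hα : ∀ σ, ((evenInversions n).subtype.comp ψ σ).right = α * σ * α⁻¹) (t : Bool) :
    TypeD n →* TypeD n :=
  ((extendHom ((evenInversions n).subtype.comp ψ) α hα (false, t)).comp
    (evenInversions n).subtype).codRestrict (evenInversions n) fun w =>
      extendHom_mem_evenInversions (fun σ => (ψ σ).2) α hα t w.2

theorem card_typeD (hn : 0 < n) : Nat.card (TypeD n) * 2 = 2 ^ n * n ! := by
  -- `D_n` is the kernel of the product of signs, a character that is onto only when there is a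
  -- coordinate to invert.
  let f : TypeC n →* ℤˣ := SemidirectProduct.lift (signProd n) 1 fun σ => by
    refine MonoidHom.ext fun v => ?_
    change ∏ i, v (σ⁻¹ i) = 1 * signProd n v * 1⁻¹
    rw [Equiv.prod_comp σ⁻¹ v, one_mul, inv_one, mul_one]
    rfl
  have hf : ∀ w, f w = signProd n w.left := fun w => mul_one _
  have hker : f.ker = evenInversions n := by
    ext w
    rw [MonoidHom.mem_ker, hf, mem_evenInversions_iff]
  have hrange : f.range = ⊤ := by
    rw [MonoidHom.range_eq_top]
    intro x
    rcases Int.units_eq_one_or x with rfl | rfl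
    · exact ⟨1, map_one f⟩
    · refine ⟨SemidirectProduct.inl (signAt ⟨0, hn⟩), ?_⟩
      rw [hf, SemidirectProduct.left_inl, signProd_signAt]
  have h := card_range_mul_card_ker f
  rw [hrange, hker, Subgroup.card_top, card_typeC] at h
  rw [← h, mul_comm]
  simp [Nat.card_eq_fintype_card]

theorem card_not_injective_typeD_le (hn : 5 ≤ n) :
    Nat.card {f : TypeD n →* TypeD n // ¬ Function.Injective (f.comp (evenInr n))} ≤
      4 ^ n * numCommutingInvolutions n := by
  have hxy : (⟨0, by omega⟩ : Fin n) ≠ ⟨1, by omega⟩ := by simp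
  set s := Equiv.swap (⟨0, by omega⟩ : Fin n) ⟨1, by omega⟩ with hs
  have hkill : ∀ f : {f : TypeD n →* TypeD n // ¬ Function.Injective (f.comp (evenInr n))},
      ∀ σ ∈ alternatingGroup (Fin n), f.1.comp (evenInr n) σ = 1 := fun f σ hσ =>
    map_eq_one_of_mem_alternatingGroup (by simpa using hn) _ f.2 hσ
  -- Even permutations cycling `i`, `j`, `k` identify the images of the three pair signs. As two of
  -- these multiply to the third, the common image is trivial, so all even signs are killed.
  have hinl : ∀ f : {f : TypeD n →* TypeD n // ¬ Function.Injective (f.comp (evenInr n))},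
      f.1.comp (evenInl n) = 1 := fun f => by
    refine monoidHom_evenSigns_ext ⟨0, by omega⟩ fun i hi => ?_
    obtain ⟨k, hk⟩ := Finset.exists_notMem_of_card_lt ({i, ⟨0, by omega⟩} : Finset (Fin n))
      (lt_of_le_of_lt Finset.card_le_two (by simp; omega))
    simp only [Finset.mem_insert, Finset.mem_singleton, not_or] at hk
    generalize (⟨0, by omega⟩ : Fin n) = j at hi hk
    have hσ : ∀ σ ∈ alternatingGroup (Fin n), ∀ a b,
        f.1 (evenInl n (pairSign (σ a) (σ b))) = f.1 (evenInl n (pairSign a b)) := fun σ hσ a b => by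
      rw [evenInl_pairSign, map_mul, map_mul, map_inv,
        show f.1 (evenInr n σ) = 1 from hkill f σ hσ, one_mul, inv_one, mul_one]
    have h1 := hσ _ (Equiv.swap_mul_swap_mem_alternatingGroup hi (Ne.symm hk.1))
    have e1 : (Equiv.swap i j * Equiv.swap i k) i = k := by
      rw [Equiv.Perm.mul_apply, Equiv.swap_apply_left, Equiv.swap_apply_of_ne_of_ne hk.1 hk.2]
    have e2 : (Equiv.swap i j * Equiv.swap i k) j = i := by
      rw [Equiv.Perm.mul_apply, Equiv.swap_apply_of_ne_of_ne hi.symm (Ne.symm hk.2),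
        Equiv.swap_apply_right]
    have e3 : (Equiv.swap i j * Equiv.swap i k) k = j := by
      rw [Equiv.Perm.mul_apply, Equiv.swap_apply_right, Equiv.swap_apply_left]
    have h2 := h1 i j
    have h3 := h1 j k
    rw [e1, e2, pairSign_comm] at h2
    rw [e2, e3] at h3
    have h4 : f.1 (evenInl n (pairSign i j)) * f.1 (evenInl n (pairSign j k)) =
        f.1 (evenInl n (pairSign i k)) := by
      rw [← map_mul, ← map_mul, pairSign_mul_pairSign]
    rw [h2, ← h3, mul_eq_left] at h4
    exact h4
  let F : {f : TypeD n →* TypeD n // ¬ Function.Injective (f.comp (evenInr n))} →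
      {x : TypeC n // x * x = 1} := fun f =>
    ⟨(f.1 (evenInr n s)).1, by
      have : f.1 (evenInr n s) * f.1 (evenInr n s) = 1 := by
        rw [← map_mul, ← map_mul, hs, Equiv.swap_mul_self, map_one, map_one]
      exact congrArg Subtype.val this⟩
  have hF : Function.Injective F := fun f g h => by
    refine Subtype.ext (typeD_hom_ext ((hinl f).trans (hinl g).symm)
      (monoidHom_perm_ext (hkill f) (hkill g) hxy ?_))
    exact Subtype.ext (Subtype.mk.inj h)
  exact (Nat.card_le_card_of_injective F hF).trans
    ((card_involutions_le _).trans (card_commutingInvolutions_typeC_le n))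

/-- `D_n` has half the order of `C_n`, so the bound `2 * n !` on the image becomes the ratio `4 / 2
^ n`. -/
theorem abs_imageOrder_extendHomD_sub_le (hn : 0 < n) (ψ : Equiv.Perm (Fin n) →* TypeD n)
    (α : Equiv.Perm (Fin n))
    (hα : ∀ σ, ((evenInversions n).subtype.comp ψ σ).right = α * σ * α⁻¹) (t : Bool) :
    |imageOrder (extendHomD ψ α hα t) / (Nat.card (TypeD n) : ℝ) - (if t then 1 else 0)| ≤
      4 / 2 ^ n := by
  cases t with
  | false =>
    have hf : (0 : ℝ) < (n ! : ℝ) := by exact_mod_cast Nat.factorial_pos n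
    have hD : (Nat.card (TypeD n) : ℝ) = 2 ^ n * (n ! : ℝ) / 2 := by
      rw [eq_div_iff (by norm_num)]
      exact_mod_cast card_typeD hn
    have hle : Nat.card (extendHomD ψ α hα false).range ≤ 2 * n ! := by
      refine le_trans (Nat.card_le_card_of_injective
        (fun x => (⟨x.1.1, ?_⟩ :
          (extendHom ((evenInversions n).subtype.comp ψ) α hα (false, false)).range))
        fun x y h => Subtype.ext (Subtype.ext (Subtype.mk.inj h)))
        (card_range_extendHom_le _ α hα false)
      obtain ⟨_, w, rfl⟩ := x
      exact ⟨w.1, rfl⟩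
    simp only [Bool.false_eq_true, if_false, sub_zero]
    rw [abs_of_nonneg (by rw [imageOrder]; positivity), hD, imageOrder]
    calc (Nat.card (extendHomD ψ α hα false).range : ℝ) / (2 ^ n * (n ! : ℝ) / 2)
        ≤ ((2 * n ! : ℕ) : ℝ) / (2 ^ n * (n ! : ℝ) / 2) := by gcongr
      _ = 4 / 2 ^ n := by
          push_cast
          field_simp
          norm_num
  | true =>
    have hinj : Function.Injective (extendHomD ψ α hα true) := by
      refine (injective_iff_map_eq_one _).2 fun w hw => ?_
      have h1 := (extendHom_eq_one_iff _ α hα _ _).1 (congrArg Subtype.val hw)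
      rw [scalarHom_true_eq_one_iff] at h1
      simp only [Bool.false_eq_true, false_and, or_false] at h1
      exact Subtype.ext (SemidirectProduct.ext h1.2 h1.1)
    rw [imageOrder_div_of_injective hinj, if_pos rfl, sub_self, abs_zero]
    positivity

theorem tendsto_imageOrder_typeD :
    Tendsto (fun n => expectedImageOrder (TypeD n) / (Nat.card (TypeD n) : ℝ)) atTop
      (nhds (1 / 2)) ∧
    Tendsto (fun n => stdDevImageOrder (TypeD n) / (Nat.card (TypeD n) : ℝ)) atTop
      (nhds (1 / 2)) := by
  have := tendsto_imageOrder_of_model (G := TypeD) (T := Bool)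
    (c := fun t => if t then 1 else 0) (fun t => by split_ifs <;> simp)
    (δ := fun n => 4 / 2 ^ n) (fun k => by positivity) tendsto_four_div_two_pow tendsto_id ?_ ?_
  · have h1 : (∑ t : Bool, if t then (1 : ℝ) else 0) / (Nat.card Bool : ℝ) = 1 / 2 := by
      simp [Nat.card_eq_fintype_card]
    have h2 : (∑ t : Bool, (if t then (1 : ℝ) else 0) ^ 2) / (Nat.card Bool : ℝ) = 1 / 2 := by
      simp [Nat.card_eq_fintype_card]
    rw [h1, h2] at this
    have h3 : √((1 : ℝ) / 2 - (1 / 2) ^ 2) = 1 / 2 := by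
      rw [show (1 : ℝ) / 2 - (1 / 2) ^ 2 = (1 / 2) ^ 2 by norm_num, Real.sqrt_sq (by norm_num)]
    rwa [h3] at this
  · filter_upwards [eventually_ge_atTop 3] with n hn
    exact factorial_le_card_end hn (evenInr n)
      (SemidirectProduct.rightHom.comp (evenInversions n).subtype) fun σ => rfl
  · filter_upwards [eventually_ge_atTop 7] with n hn
    choose α hα using fun ψ : {ψ : Equiv.Perm (Fin n) →* TypeD n // Function.Injective ψ} =>
      exists_right_eq_conj (ψ := (evenInversions n).subtype.comp ψ.1) hn
        ((evenInversions n).subtype_injective.comp ψ.2)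
    have : Finite (Equiv.Perm (Fin n) →* TypeD n) :=
      Finite.of_injective _ DFunLike.coe_injective
    let F : {ψ : Equiv.Perm (Fin n) →* TypeD n // Function.Injective ψ} × Bool →
        (TypeD n →* TypeD n) := fun x => extendHomD x.1.1 (α x.1) (hα x.1) x.2
    have hmem : ∀ f, f ∉ Set.range F → ¬ Function.Injective (f.comp (evenInr n)) :=
      fun f hf hinj => by
        obtain ⟨t, ht⟩ := eq_extendHom_of_typeD hn ((evenInversions n).subtype.comp f)
          (α ⟨_, hinj⟩) (hα ⟨_, hinj⟩)
        exact hf ⟨(⟨_, hinj⟩, t), MonoidHom.ext fun w =>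
          Subtype.ext (DFunLike.congr_fun ht w).symm⟩
    refine ⟨_, inferInstance, F, ?_, ?_, fun ψ t =>
      abs_imageOrder_extendHomD_sub_le (by omega) ψ.1 (α ψ) (hα ψ) t⟩
    · rintro ⟨ψ, s⟩ ⟨ψ', t⟩ h
      have h1 : ψ = ψ' := Subtype.ext (MonoidHom.ext fun σ => by
        have h2 := congrArg Subtype.val (DFunLike.congr_fun h (evenInr n σ))
        exact Subtype.ext (((extendHom_inr _ _ (hα ψ) (false, s) σ).symm.trans h2).trans
          (extendHom_inr _ _ (hα ψ') (false, t) σ)))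
      subst h1
      refine Prod.ext rfl ?_
      -- Two types giving the same endomorphism would place one ratio within `4 / 2 ^ 7` of both `0`
      -- and `1`.
      by_contra hst
      have hcard : ∀ t, |imageOrder (F (ψ, t)) / (Nat.card (TypeD n) : ℝ) -
          (if t then 1 else 0)| ≤ 4 / 2 ^ n := fun t =>
        abs_imageOrder_extendHomD_sub_le (by omega) ψ.1 (α ψ) (hα ψ) t
      have hs := hcard s
      have ht := hcard t
      rw [h] at hs
      have hpow : (4 : ℝ) / 2 ^ n ≤ 4 / 2 ^ 7 := by
        gcongr
        norm_num
      rw [abs_le] at hs ht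
      revert hs ht
      cases s <;> cases t <;> simp at hst ⊢ <;> intros <;> linarith
    · exact le_trans (Nat.card_le_card_of_injective
        (fun f : {f // f ∉ Set.range F} =>
          (⟨f.1, hmem f.1 f.2⟩ :
            {f : TypeD n →* TypeD n // ¬ Function.Injective (f.comp (evenInr n))}))
        fun f g h => Subtype.ext (Subtype.mk.inj h))
        (card_not_injective_typeD_le (n := n) (by omega))

end TypeD

/-! ### Numerical values and the asymptotic statements -/

theorem sum_imageRatio (even : Bool) :
    (∑ t, imageRatio even t) / (Nat.card (Bool × Bool) : ℝ) = if even then 1 / 2 else 3 / 8 := by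
  rw [Fintype.sum_prod_type]
  cases even <;> simp [imageRatio, Nat.card_eq_fintype_card] <;> norm_num

theorem sqrt_variance_imageRatio (even : Bool) :
    √((∑ t, imageRatio even t ^ 2) / (Nat.card (Bool × Bool) : ℝ) -
        ((∑ t, imageRatio even t) / (Nat.card (Bool × Bool) : ℝ)) ^ 2) =
      if even then 1 / 2 else √11 / 8 := by
  rw [sum_imageRatio]
  cases even
  · have h : (∑ t, imageRatio false t ^ 2) / (Nat.card (Bool × Bool) : ℝ) = 5 / 16 := by
      simp [imageRatio, Fintype.sum_prod_type, Nat.card_eq_fintype_card]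
      norm_num
    rw [h]
    simp only [Bool.false_eq_true, if_false]
    -- The second moment is `(1 + 1/4) / 4 = 5/16`.
    rw [show (5 : ℝ) / 16 - (3 / 8) ^ 2 = 11 / 8 ^ 2 by norm_num,
      Real.sqrt_div (by norm_num), Real.sqrt_sq (by norm_num)]
  · have h : (∑ t, imageRatio true t ^ 2) / (Nat.card (Bool × Bool) : ℝ) = 1 / 2 := by
      rw [Fintype.sum_prod_type]
      simp [imageRatio, Nat.card_eq_fintype_card]
      norm_num
    rw [h]
    simp only [if_true]
    rw [show (1 : ℝ) / 2 - (1 / 2) ^ 2 = (1 / 2) ^ 2 by norm_num, Real.sqrt_sq (by norm_num)]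

theorem card_typeC_two_mul (n : ℕ) :
    (Nat.card (TypeC (2 * n)) : ℝ) = 2 * ((2 : ℝ) ^ (2 * (n : ℤ) - 1) * ((2 * n)! : ℝ)) := by
  rw [card_typeC, zpow_sub₀ (by norm_num), show 2 * (n : ℤ) = ((2 * n : ℕ) : ℤ) by push_cast; rfl,
    zpow_natCast]
  push_cast
  ring

theorem card_typeC_two_mul_add_one (n : ℕ) :
    (Nat.card (TypeC (2 * n + 1)) : ℝ) =
      8 * ((2 : ℝ) ^ (2 * (n : ℤ) - 2) * ((2 * n + 1)! : ℝ)) := by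
  rw [card_typeC, zpow_sub₀ (by norm_num), show 2 * (n : ℤ) = ((2 * n : ℕ) : ℤ) by push_cast; rfl,
    zpow_natCast, pow_succ]
  push_cast
  rw [show (2 : ℝ) ^ (2 : ℤ) = 4 by norm_num]
  ring

theorem card_typeD_eq {n : ℕ} (hn : 0 < n) :
    (Nat.card (TypeD n) : ℝ) = 2 * ((2 : ℝ) ^ ((n : ℤ) - 2) * (n ! : ℝ)) := by
  have h : (Nat.card (TypeD n) : ℝ) * 2 = 2 ^ n * (n ! : ℝ) := by exact_mod_cast card_typeD hn
  rw [zpow_sub₀ (by norm_num), zpow_natCast, show (2 : ℝ) ^ (2 : ℤ) = 4 by norm_num]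
  linarith

theorem card_typeA (n : ℕ) : (Nat.card (TypeA n) : ℝ) = ((n + 1)! : ℝ) := by
  rw [Nat.card_eq_fintype_card, Fintype.card_perm, Fintype.card_fin]

theorem theorem3 :
    ((fun n : ℕ => expectedImageOrder (TypeC (2 * n)))
        ~[atTop] fun n : ℕ => (2 : ℝ) ^ (2 * (n : ℤ) - 1) * ((2 * n)! : ℝ)) ∧
    ((fun n : ℕ => expectedImageOrder (TypeC (2 * n + 1)))
        ~[atTop] fun n : ℕ => 3 * (2 : ℝ) ^ (2 * (n : ℤ) - 2) * ((2 * n + 1)! : ℝ)) ∧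
    ((fun n : ℕ => expectedImageOrder (TypeD n))
        ~[atTop] fun n : ℕ => (2 : ℝ) ^ ((n : ℤ) - 2) * (n ! : ℝ)) ∧
    ((fun n : ℕ => expectedImageOrder (TypeA n))
        ~[atTop] fun n : ℕ => ((n + 1)! : ℝ)) ∧
    ((fun n : ℕ => stdDevImageOrder (TypeC (2 * n)))
        ~[atTop] fun n : ℕ => (2 : ℝ) ^ (2 * (n : ℤ) - 1) * ((2 * n)! : ℝ)) ∧
    ((fun n : ℕ => stdDevImageOrder (TypeC (2 * n + 1)))
        ~[atTop] fun n : ℕ => √11 * (2 : ℝ) ^ (2 * (n : ℤ) - 2) * ((2 * n + 1)! : ℝ)) ∧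
    ((fun n : ℕ => stdDevImageOrder (TypeD n))
        ~[atTop] fun n : ℕ => (2 : ℝ) ^ ((n : ℤ) - 2) * (n ! : ℝ)) ∧
    ((fun n : ℕ => stdDevImageOrder (TypeA n))
        =o[atTop] fun n : ℕ => ((n + 1)! : ℝ)) := by
  have hcard : ∀ (G : ℕ → Type) [∀ k, Group (G k)] [∀ k, Finite (G k)] (k : ℕ),
      (Nat.card (G k) : ℝ) ≠ 0 := fun G _ _ k => Nat.cast_ne_zero.2 Nat.card_pos.ne'
  have hd0 : Tendsto (fun n : ℕ => 2 * n) atTop atTop :=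
    tendsto_atTop_mono (fun n => by rw [id]; omega) tendsto_id
  have hd1 : Tendsto (fun n : ℕ => 2 * n + 1) atTop atTop :=
    tendsto_atTop_mono (fun n => by rw [id]; omega) tendsto_id
  obtain ⟨e0, s0⟩ := tendsto_imageOrder_typeC hd0 (even := true) fun k => by simp
  obtain ⟨e1, s1⟩ := tendsto_imageOrder_typeC hd1 (even := false) fun k => by simp
  rw [sum_imageRatio] at e0 e1
  rw [sqrt_variance_imageRatio] at s0 s1
  simp only [if_true, Bool.false_eq_true, if_false] at e0 e1 s0 s1
  obtain ⟨eD, sD⟩ := tendsto_imageOrder_typeD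
  obtain ⟨eA, sA⟩ := tendsto_imageOrder_typeA
  have h11 : √11 / 8 ≠ 0 := by positivity
  -- Only eventual equality holds: at `n = 0` the group is trivial and the formula gives `1/4`
  -- instead of `1/2`.
  have hD : (fun n => (1 / 2 : ℝ) * (Nat.card (TypeD n) : ℝ)) =ᶠ[atTop]
      fun n : ℕ => (2 : ℝ) ^ ((n : ℤ) - 2) * (n ! : ℝ) := by
    filter_upwards [eventually_gt_atTop 0] with n hn
    rw [card_typeD_eq hn]
    ring
  refine ⟨?_, ?_, ?_, ?_, ?_, ?_, ?_, ?_⟩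
  · exact isEquivalent_of_tendsto_div (by norm_num) (hcard fun n => TypeC (2 * n)) e0
      fun n => by rw [card_typeC_two_mul]; ring
  · exact isEquivalent_of_tendsto_div (by norm_num) (hcard fun n => TypeC (2 * n + 1)) e1
      fun n => by rw [card_typeC_two_mul_add_one]; ring
  · exact (isEquivalent_of_tendsto_div (by norm_num) (hcard TypeD) eD fun n => rfl).trans
      hD.isEquivalent
  · exact isEquivalent_of_tendsto_div one_ne_zero (hcard TypeA) eA
      fun n => by rw [card_typeA, one_mul]
  · exact isEquivalent_of_tendsto_div (by norm_num) (hcard fun n => TypeC (2 * n)) s0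
      fun n => by rw [card_typeC_two_mul]; ring
  · exact isEquivalent_of_tendsto_div h11 (hcard fun n => TypeC (2 * n + 1)) s1
      fun n => by rw [card_typeC_two_mul_add_one]; ring
  · exact (isEquivalent_of_tendsto_div (by norm_num) (hcard TypeD) sD fun n => rfl).trans
      hD.isEquivalent
  · refine (isLittleO_iff_tendsto fun n hn => absurd hn ?_).2 ?_
    · exact_mod_cast (Nat.factorial_pos (n + 1)).ne'
    · simpa only [card_typeA] using sA
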